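/- Theorem. Let $T>0$, $1<p<\infty$, let $\Theta\subset\mathbb{R}^l$ be compact and let $\mathcal{U}:=L^p([0,T],\mathbb{R}^k)$. Let $F_0:\mathbb{R}^d\times\Theta\to\mathbb{R}^d$ and $F=(F_1,\dots,F_k):\mathbb{R}^d\times\Theta\to\mathbb{R}^{d\times k}$ satisfy, for some $L>0$, $$\sup_{i=0,\dots,k}|F_i(x_1,\theta_1)-F_i(x_2,\theta_2)|_2\le L\big(|x_1-x_2|_2+|x_1+x_2|_2\,|\theta_1-\theta_2|_2\big)$$ for all $(x_1,\theta_1),(x_2,\theta_2)\in\mathbb{R}^d\times\Theta$, let $x_0:\Theta\to\mathbb{R}^d$ be continuous, let $a:\mathbb{R}^d\times\Theta\to[0,\infty)$ be continuous, and let $f:[0,T]\times\mathbb{R}^k\to\mathbb{R}$ be such that: (i) $f(\cdot,w)$ is measurable for every $w\in\mathbb{R}^k$; (ii) $f(t,\cdot)$ is continuous and convex for a.e. $t\in[0,T]$; (iii) there are a non-negative $c\in L^1([0,T])$ and $C>0$ with $f(t,w)\ge C|w|_2^p-c(t)$ for a.e. $t\in[0,T]$ and every $w\in\mathbb{R}^k$;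 (iv) there are $w'\in\mathbb{R}^k$ and a non-negative $c'\in L^1([0,T])$ with $|f(t,w')|\le c'(t)$ for a.e. $t\in[0,T]$. For $u\in\mathcal{U}$ and $\theta\in\Theta$ let $x_u^\theta:[0,T]\to\mathbb{R}^d$ be the Carathéodory solution of $\dot x=F_0(x,\theta)+F(x,\theta)u(t)$ a.e. in $[0,T]$, $x(0)=x_0(\theta)$. Let $\Theta^N\subseteq\Theta$, $N\in\mathbb{N}\cup\{\infty\}$, be non-empty compact sets whose Hausdorff distances satisfy $d_H(\Theta^N,\Theta^\infty)\to0$ as $N\to\infty$, and set $$\mathcal{J}^N(u):=\max_{\theta\in\Theta^N}a(x_u^\theta(T),\theta)+\int_0^Tf(t,u(t))\,dt\in\mathbb{R}\cup\{+\infty\},\qquad u\in\mathcal{U},\ N\in\mathbb{N}\cup\{\infty\}.$$ Then these objects are well defined: for all $u\in\mathcal{U}$ and $\theta\in\Theta$ the solution $x_u^\theta$ exists and is unique, and for every non-empty compact $S\subseteq\Theta$ the maximum over $S$ is attained and the resulting functional does not take the value $-\infty$. Moreover, there is $\rho>0$ such that $$\text{for every }N\in\mathbb{N}\cup\{\infty\},\text{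 every minimizer }u\text{ of }\mathcal{J}^N\text{ over }\mathcal{U}\text{ satisfies }\|u\|_{L^p}\le\rho,\qquad(\ast)$$ and for every $\rho>0$ with the property $(\ast)$ the following holds, where $\mathcal{X}:=\{u\in\mathcal{U}:\|u\|_{L^p}\le\rho\}$ carries the weak topology of $L^p$ and $\mathcal{J}^N$ is restricted to $\mathcal{X}$. (a) $\mathcal{J}^N$ $\Gamma$-converges to $\mathcal{J}^\infty$ on $\mathcal{X}$: if $u_N\to u$ in $\mathcal{X}$, then $\mathcal{J}^\infty(u)\le\liminf_{N\to\infty}\mathcal{J}^N(u_N)$, and for every $u\in\mathcal{X}$ there is a sequence $u_N\to u$ in $\mathcal{X}$ with $\limsup_{N\to\infty}\mathcal{J}^N(u_N)\le\mathcal{J}^\infty(u)$. (b) $\lim_{N\to\infty}\inf_{\mathcal{X}}\mathcal{J}^N=\inf_{\mathcal{X}}\mathcal{J}^\infty$. (c) If $u_N^*\in\mathcal{X}$ is a minimizer of $\mathcal{J}^N$ over $\mathcal{X}$ for every $N\in\mathbb{N}$, then the sequence $(u_N^*)_{N\in\mathbb{N}}$ is pre-compact in the weak topology of $L^p$, and every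 limit point of it is a minimizer of $\mathcal{J}^\infty$ over $\mathcal{X}$. -/

import Mathlib

open MeasureTheory Filter Topology
open scoped ENNReal

namespace MinimaxEnsemble

noncomputable section

/-- `ℝⁿ` with its Euclidean norm. -/
abbrev Vec (n : ℕ) := EuclideanSpace ℝ (Fin n)

/-- Lebesgue measure on the time interval `[0, T]`. -/
abbrev timeMeasure (T : ℝ) : Measure ℝ := volume.restrict (Set.Icc 0 T)

/-- The space of controls `L^p([0, T], ℝᵏ)`. -/
abbrev Control (T : ℝ) (k : ℕ) (p : ℝ≥0∞) := Lp (Vec k) p (timeMeasure T)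

variable {d k l : ℕ}

/-- Standing hypothesis on the drift `F₀` and on the controlled fields `F = (F₁, …, F_k)`. -/
def LipschitzFields (Θ : Set (Vec l)) (F₀ : Vec d → Vec l → Vec d)
    (F : Vec d → Vec l → Fin k → Vec d) : Prop :=
  ∃ L : ℝ, 0 < L ∧ ∀ x₁ x₂ : Vec d, ∀ θ₁ ∈ Θ, ∀ θ₂ ∈ Θ,
    ‖F₀ x₁ θ₁ - F₀ x₂ θ₂‖ ≤ L * (‖x₁ - x₂‖ + ‖x₁ + x₂‖ * ‖θ₁ - θ₂‖) ∧
    ∀ i, ‖F x₁ θ₁ i - F x₂ θ₂ i‖ ≤ L * (‖x₁ - x₂‖ + ‖x₁ + x₂‖ * ‖θ₁ - θ₂‖)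

/-- Hypothesis on the terminal cost `a : ℝᵈ × Θ → ℝ₊`: continuous and non-negative. -/
structure TerminalCost (Θ : Set (Vec l)) (a : Vec d → Vec l → ℝ) : Prop where
  continuousOn : ContinuousOn (fun z : Vec d × Vec l => a z.1 z.2) (Set.univ ×ˢ Θ)
  nonneg : ∀ x, ∀ θ ∈ Θ, 0 ≤ a x θ

/-- Hypotheses on the running cost `f : [0, T] × ℝᵏ → ℝ`, for the exponent `p`.
`AEMeasurable` with respect to Lebesgue measure on `[0, T]` is Lebesgue measurability. -/
structure RunningCost (T : ℝ) (p : ℝ≥0∞) (f : ℝ → Vec k → ℝ) : Prop where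
  measurable : ∀ w, AEMeasurable (fun t => f t w) (timeMeasure T)
  continuous : ∀ᵐ t ∂timeMeasure T, Continuous (f t)
  convex : ∀ᵐ t ∂timeMeasure T, ConvexOn ℝ Set.univ (f t)
  growth : ∃ (c : ℝ → ℝ) (C : ℝ), Integrable c (timeMeasure T) ∧
    (∀ᵐ t ∂timeMeasure T, 0 ≤ c t) ∧ 0 < C ∧
    ∀ᵐ t ∂timeMeasure T, ∀ w, C * ‖w‖ ^ p.toReal - c t ≤ f t w
  finite : ∃ (w' : Vec k) (c' : ℝ → ℝ), Integrable c' (timeMeasure T) ∧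
    (∀ᵐ t ∂timeMeasure T, 0 ≤ c' t) ∧ ∀ᵐ t ∂timeMeasure T, |f t w'| ≤ c' t

/-- `x` is on `[0, T]` a Carathéodory solution of
`x' = F₀(x, θ) + ∑ᵢ uᵢ Fᵢ(x, θ)`, `x(0) = x₀(θ)`: it is continuous, and the equation holds in
integrated form (so `x` is absolutely continuous and the equation holds almost everywhere). -/
structure IsTrajectory (T : ℝ) (F₀ : Vec d → Vec l → Vec d) (F : Vec d → Vec l → Fin k → Vec d)
    (x₀ : Vec l → Vec d) (u : ℝ → Vec k) (θ : Vec l) (x : ℝ → Vec d) : Prop where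
  continuousOn : ContinuousOn x (Set.Icc 0 T)
  intervalIntegrable :
    IntervalIntegrable (fun s => F₀ (x s) θ + ∑ i, u s i • F (x s) θ i) volume 0 T
  eq_integral : ∀ t ∈ Set.Icc 0 T,
    x t = x₀ θ + ∫ s in (0 : ℝ)..t, (F₀ (x s) θ + ∑ i, u s i • F (x s) θ i)

open Classical in
/-- The trajectory `x_u^θ` (a chosen solution; the value is `0` if there is none). -/
def trajectory (T : ℝ) (F₀ : Vec d → Vec l → Vec d) (F : Vec d → Vec l → Fin k → Vec d)
    (x₀ : Vec l → Vec d) (u : ℝ → Vec k) (θ : Vec l) : ℝ → Vec d :=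
  if h : ∃ x, IsTrajectory T F₀ F x₀ u θ x then h.choose else 0

/-- The integral of a real function as an extended real number, namely the integral of the positive
part minus the integral of the negative part. -/
def extIntegral (μ : Measure ℝ) (g : ℝ → ℝ) : EReal :=
  ((∫⁻ t, ENNReal.ofReal (g t) ∂μ : ℝ≥0∞) : EReal)
    - ((∫⁻ t, ENNReal.ofReal (-g t) ∂μ : ℝ≥0∞) : EReal)

/-- The minimax functional
`J(u) = max_{θ ∈ S} a(x_u^θ(T), θ) + ∫₀ᵀ f(t, u(t)) dt` over the set of parameters `S`. -/
def minimaxCost {p : ℝ≥0∞} (T : ℝ) (F₀ : Vec d → Vec l → Vec d)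
    (F : Vec d → Vec l → Fin k → Vec d) (x₀ : Vec l → Vec d) (a : Vec d → Vec l → ℝ)
    (f : ℝ → Vec k → ℝ) (S : Set (Vec l)) (u : Control T k p) : EReal :=
  (⨆ θ ∈ S, (a (trajectory T F₀ F x₀ u θ T) θ : EReal))
    + extIntegral (timeMeasure T) (fun t => f t (u t))

/-- `v` is a (global) minimizer of `G`. -/
def IsMinimizer {X : Type*} (G : X → EReal) (v : X) : Prop := ∀ w, G v ≤ G w

/-- The closed ball of radius `ρ` in `L^p([0, T], ℝᵏ)`, as a set in `L^p` with its weak topology. -/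
def weakBall (T : ℝ) (k : ℕ) (p : ℝ≥0∞) [Fact (1 ≤ p)] (ρ : ℝ) :
    Set (WeakSpace ℝ (Control T k p)) :=
  {u | ‖(toWeakSpace ℝ (Control T k p)).symm u‖ ≤ ρ}

/-- The restriction of a functional on `L^p` to the closed ball of radius `ρ`. -/
def restrictBall {T : ℝ} {p : ℝ≥0∞} [Fact (1 ≤ p)] (ρ : ℝ)
    (J : Control T k p → EReal) (u : weakBall T k p ρ) : EReal :=
  J ((toWeakSpace ℝ (Control T k p)).symm u.1)

/-- (Sequential) `Γ`-convergence of the functionals `G N` to `G'`. -/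
structure GammaConverges {X : Type*} [TopologicalSpace X]
    (G : ℕ → X → EReal) (G' : X → EReal) : Prop where
  liminf_le : ∀ (u : ℕ → X) (v : X), Tendsto u atTop (𝓝 v) →
    G' v ≤ liminf (fun N => G N (u N)) atTop
  limsup_le : ∀ v : X, ∃ u : ℕ → X, Tendsto u atTop (𝓝 v) ∧
    limsup (fun N => G N (u N)) atTop ≤ G' v

end

end MinimaxEnsemble

/-! On a ball `‖u‖ ≤ ρ` the functionals differ only in their terminal maxima, and these converge
uniformly. By Grönwall, trajectories are bounded and continuous in `θ` with constants that see the
control only through its `L¹` norm. Hence `θ ↦ a(x_u^θ(T), θ)` has a modulus of continuity common to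
the whole ball (`FieldBounds.exists_terminalCost_modulus`), and a small Hausdorff distance changes
the maximum by at most `ε`, whatever `u` is.

Uniform convergence to a lower semicontinuous limit gives all of (a), (b) and the statement on limit
points in (c); this is the abstract content of `UniformApprox`.

Weak lower semicontinuity of the limit has two sources. The endpoint `x_u^θ(T)` is weakly continuous
on balls (`FieldBounds.continuous_trajectory_endpoint`), because the system is affine in `u` and
weak convergence is needed only along one fixed curve; a supremum of continuous functions is then
lower semicontinuous. The running cost has convex sublevel sets that are norm closed by Fatou, hence
weakly closed.

Pre-compactness is weak compactness of balls in `L^p`, obtained from uniform convexity of `‖·‖^p`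
(`uniformlyConvexGap_Lp`). The radius `ρ` comes from comparing a minimizer with the constant control
`w'` and using the growth of `f`. -/

namespace MinimaxEnsemble

/-! ### Grönwall's inequality and integral equations with an integrable kernel -/

section Gronwall

variable {T : ℝ} {β : ℝ → ℝ}

theorem intervalIntegrable_subinterval {E : Type*} [NormedAddCommGroup E] {g : ℝ → E}
    (hg : IntervalIntegrable g volume 0 T) {s t : ℝ} (hs : s ∈ Set.Icc 0 T)
    (ht : t ∈ Set.Icc 0 T) : IntervalIntegrable g volume s t :=
  hg.mono_set (Set.uIcc_subset_uIcc (Set.Icc_subset_uIcc hs) (Set.Icc_subset_uIcc ht))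

theorem continuousOn_primitive_Icc {E : Type*} [NormedAddCommGroup E] [NormedSpace ℝ E]
    {g : ℝ → E} (hT : 0 ≤ T) (hg : IntervalIntegrable g volume 0 T) :
    ContinuousOn (fun t => ∫ s in (0 : ℝ)..t, g s) (Set.Icc 0 T) := by
  have := intervalIntegral.continuousOn_primitive_interval' hg (Set.left_mem_uIcc)
  rwa [Set.uIcc_of_le hT] at this

/-- With `B` the primitive of `β`, the integrand is a.e. half the derivative of the monotone
function `exp (2B)`, and the integral of the derivative of a monotone function is at most its
increment. The factor 1/2 is what makes the weight `exp (-2B)` produce a contraction. -/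
theorem integral_mul_exp_le (hβ : ∀ s, 0 ≤ β s) (hint : IntervalIntegrable β volume 0 T) {t : ℝ}
    (ht : t ∈ Set.Icc 0 T) :
    ∫ s in (0 : ℝ)..t, β s * Real.exp (2 * ∫ r in (0 : ℝ)..s, β r)
      ≤ (Real.exp (2 * ∫ r in (0 : ℝ)..t, β r) - 1) / 2 := by
  have h0 : (0 : ℝ) ∈ Set.Icc 0 T := ⟨le_rfl, ht.1.trans ht.2⟩
  have hint' := intervalIntegrable_subinterval hint h0 ht
  set g : ℝ → ℝ := fun s => Real.exp (2 * ∫ r in (0 : ℝ)..s, β r) with hg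
  have hmono : MonotoneOn g (Set.uIcc 0 t) := by
    rw [Set.uIcc_of_le ht.1]
    intro a ha b hb hab
    have := intervalIntegral.integral_add_adjacent_intervals
      (intervalIntegrable_subinterval hint' ⟨le_rfl, ht.1⟩ ha)
      (intervalIntegrable_subinterval hint' ha hb)
    have h2 : 0 ≤ ∫ r in a..b, β r := intervalIntegral.integral_nonneg hab fun _ _ => hβ _
    simp only [hg, Real.exp_le_exp]
    linarith
  have h1 := hmono.intervalIntegral_deriv_mem_uIcc
  have hle : g 0 ≤ g t := hmono Set.left_mem_uIcc Set.right_mem_uIcc ht.1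
  rw [Set.uIcc_of_le (by linarith)] at h1
  have h3 : ∫ s in (0 : ℝ)..t, deriv g s = ∫ s in (0 : ℝ)..t, 2 * (β s * g s) := by
    apply intervalIntegral.integral_congr_ae
    filter_upwards [hint'.ae_hasDerivAt_integral] with x hx hxt
    have := ((hx (Set.uIoc_subset_uIcc hxt) 0 Set.left_mem_uIcc).const_mul 2).exp
    rw [this.deriv]
    simp only [hg]; ring
  rw [h3, intervalIntegral.integral_const_mul] at h1
  have : g 0 = 1 := by simp [hg]
  have h4 := h1.2
  rw [this] at h4
  simp only [hg] at h4 ⊢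
  linarith

/-- Grönwall's inequality with an integrable kernel. -/
theorem le_exp_of_le_add_integral (hβ : ∀ s, 0 ≤ β s) (hint : IntervalIntegrable β volume 0 T)
    {φ : ℝ → ℝ} (hφ : ContinuousOn φ (Set.Icc 0 T)) (hφ0 : ∀ t ∈ Set.Icc 0 T, 0 ≤ φ t) {A : ℝ}
    (hle : ∀ t ∈ Set.Icc 0 T, φ t ≤ A + ∫ s in (0 : ℝ)..t, β s * φ s) {t : ℝ}
    (ht : t ∈ Set.Icc 0 T) :
    φ t ≤ 2 * A * Real.exp (2 * ∫ s in (0 : ℝ)..t, β s) := by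
  have hT : 0 ≤ T := ht.1.trans ht.2
  have h0 : (0 : ℝ) ∈ Set.Icc 0 T := ⟨le_rfl, hT⟩
  set B : ℝ → ℝ := fun t => ∫ s in (0 : ℝ)..t, β s with hB
  have hBc : ContinuousOn B (Set.Icc 0 T) := continuousOn_primitive_Icc hT hint
  have hc : ContinuousOn (fun t => φ t * Real.exp (-(2 * B t))) (Set.Icc 0 T) := by fun_prop
  obtain ⟨t₀, ht₀, hmax⟩ := isCompact_Icc.exists_isMaxOn ⟨0, h0⟩ hc
  -- At the maximum point of the weighted function, with `E = exp (2 B t₀) ≥ 1`, the hypothesis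
  -- reads `M E ≤ A + M (E - 1) / 2`, which forces `M ≤ 2A`.
  set M := φ t₀ * Real.exp (-(2 * B t₀)) with hM
  have hM0 : 0 ≤ M := mul_nonneg (hφ0 _ ht₀) (Real.exp_nonneg _)
  have hφM : ∀ s ∈ Set.Icc 0 T, φ s ≤ M * Real.exp (2 * B s) := by
    intro s hs
    have h1 : φ s * Real.exp (-(2 * B s)) ≤ M := hmax hs
    have h2 := mul_le_mul_of_nonneg_right h1 (Real.exp_nonneg (2 * B s))
    rwa [mul_assoc, ← Real.exp_add, neg_add_cancel, Real.exp_zero, mul_one] at h2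
  have hint₀ := intervalIntegrable_subinterval hint h0 ht₀
  have hsub : Set.uIcc 0 t₀ ⊆ Set.Icc 0 T := by
    rw [Set.uIcc_of_le ht₀.1]; exact Set.Icc_subset_Icc le_rfl ht₀.2
  have h1 : ∫ s in (0 : ℝ)..t₀, β s * φ s
      ≤ ∫ s in (0 : ℝ)..t₀, M * (β s * Real.exp (2 * B s)) := by
    apply intervalIntegral.integral_mono_on ht₀.1
    · exact hint₀.mul_continuousOn (hφ.mono hsub)
    · apply IntervalIntegrable.const_mul
      apply hint₀.mul_continuousOn
      exact ContinuousOn.mono (by fun_prop) hsub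
    · intro s hs
      have := mul_le_mul_of_nonneg_left (hφM s ⟨hs.1, hs.2.trans ht₀.2⟩) (hβ s)
      linarith
  rw [intervalIntegral.integral_const_mul] at h1
  have h2 := mul_le_mul_of_nonneg_left (integral_mul_exp_le hβ hint ht₀) hM0
  have h3 : φ t₀ = M * Real.exp (2 * B t₀) := by
    rw [hM, mul_assoc, ← Real.exp_add, neg_add_cancel, Real.exp_zero, mul_one]
  have h4 := hle t₀ ht₀
  have hBn : 1 ≤ Real.exp (2 * B t₀) := by
    apply Real.one_le_exp
    have : 0 ≤ B t₀ := intervalIntegral.integral_nonneg ht₀.1 fun _ _ => hβ _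
    linarith
  have h5 : M ≤ 2 * A := by
    have h6 : M ≤ M * Real.exp (2 * B t₀) := le_mul_of_one_le_right hM0 hBn
    simp only [hB] at h1 h2 h3 h4 h6
    linarith
  exact (hφM t ht).trans (mul_le_mul_of_nonneg_right h5 (Real.exp_nonneg _))

/-- Carathéodory's existence theorem for integral equations with an integrable Lipschitz bound. -/
theorem exists_continuous_integral_eq {E : Type*} [NormedAddCommGroup E] [NormedSpace ℝ E]
    [CompleteSpace E] (hT : 0 ≤ T) (hβ : ∀ s, 0 ≤ β s) (hint : IntervalIntegrable β volume 0 T)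
    {g : ℝ → E → E} (hg : ∀ x : ℝ → E, Continuous x →
      IntervalIntegrable (fun s => g s (x s)) volume 0 T)
    (hlip : ∀ s x y, ‖g s x - g s y‖ ≤ β s * ‖x - y‖) (x₀ : E) :
    ∃ x : ℝ → E, Continuous x ∧
      ∀ t ∈ Set.Icc 0 T, x t = x₀ + ∫ s in (0 : ℝ)..t, g s (x s) := by
  have h0 : (0 : ℝ) ∈ Set.Icc 0 T := ⟨le_rfl, hT⟩
  set B : ℝ → ℝ := fun t => ∫ s in (0 : ℝ)..t, β s with hB
  have hBc : ContinuousOn B (Set.Icc 0 T) := continuousOn_primitive_Icc hT hint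
  have hBr : Continuous fun t : Set.Icc 0 T => B t := hBc.domRestrict
  -- The unknown is `y = exp (-2B) x`: in this weighted form the Picard map is a 1/2-contraction on
  -- all of `[0, T]`, so no local solutions have to be glued.
  let ext : C(Set.Icc 0 T, E) → ℝ → E := fun y =>
    Set.IccExtend hT fun t => Real.exp (2 * B t) • y t
  have hext : ∀ y, Continuous (ext y) := fun y => by
    apply Continuous.Icc_extend'
    exact (Real.continuous_exp.comp (hBr.const_mul 2)).smul y.continuous
  have hextv : ∀ y (s : ℝ) (hs : s ∈ Set.Icc 0 T), ext y s = Real.exp (2 * B s) • y ⟨s, hs⟩ :=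
    fun y s hs => Set.IccExtend_of_mem hT _ hs
  let Φ : C(Set.Icc 0 T, E) → C(Set.Icc 0 T, E) := fun y =>
    ⟨fun t => Real.exp (-(2 * B t)) • (x₀ + ∫ s in (0 : ℝ)..t, g s (ext y s)), by
      have : Continuous fun t : Set.Icc 0 T => ∫ s in (0 : ℝ)..t, g s (ext y s) :=
        (continuousOn_primitive_Icc hT (hg _ (hext y))).domRestrict
      exact (Real.continuous_exp.comp (hBr.const_mul 2).neg).smul (continuous_const.add this)⟩
  have hΦ : ContractingWith (1 / 2) Φ := by
    refine ⟨by rw [← NNReal.coe_lt_coe]; norm_num, LipschitzWith.of_dist_le_mul fun y z => ?_⟩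
    rw [ContinuousMap.dist_le (by positivity)]
    rintro ⟨t, ht⟩
    have hsub := fun {w : ℝ → E} (h : IntervalIntegrable w volume 0 T) =>
      intervalIntegrable_subinterval h h0 ht
    have h1 : ‖∫ s in (0 : ℝ)..t, (g s (ext y s) - g s (ext z s))‖
        ≤ ∫ s in (0 : ℝ)..t, dist y z * (β s * Real.exp (2 * B s)) := by
      apply intervalIntegral.norm_integral_le_of_norm_le ht.1
      · refine ae_of_all _ fun s hs => ?_
        have hsT : s ∈ Set.Icc 0 T := ⟨hs.1.le, hs.2.trans ht.2⟩
        refine (hlip s _ _).trans ?_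
        rw [hextv y s hsT, hextv z s hsT, ← smul_sub, norm_smul, Real.norm_eq_abs, Real.abs_exp,
          ← dist_eq_norm]
        have h2 := mul_le_mul_of_nonneg_left (ContinuousMap.dist_apply_le_dist (f := y) (g := z)
          ⟨s, hsT⟩) (mul_nonneg (hβ s) (Real.exp_nonneg (2 * B s)))
        linarith
      · apply IntervalIntegrable.const_mul
        apply (intervalIntegrable_subinterval hint h0 ht).mul_continuousOn
        refine ContinuousOn.mono (s := Set.Icc 0 T) (by fun_prop) ?_
        rw [Set.uIcc_of_le ht.1]; exact Set.Icc_subset_Icc le_rfl ht.2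
    rw [intervalIntegral.integral_const_mul, intervalIntegral.integral_sub
      (hsub (hg _ (hext y))) (hsub (hg _ (hext z)))] at h1
    have h2 := mul_le_mul_of_nonneg_left (integral_mul_exp_le hβ hint ht)
      (dist_nonneg (x := y) (y := z))
    have h3 : dist (Φ y ⟨t, ht⟩) (Φ z ⟨t, ht⟩) = Real.exp (-(2 * B t)) *
        ‖(∫ s in (0 : ℝ)..t, g s (ext y s)) - ∫ s in (0 : ℝ)..t, g s (ext z s)‖ := by
      simp only [Φ, ContinuousMap.coe_mk, dist_eq_norm]
      rw [← smul_sub, norm_smul, Real.norm_eq_abs, Real.abs_exp, add_sub_add_left_eq_sub]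
    rw [h3]
    have h4 : dist y z * ((Real.exp (2 * B t) - 1) / 2) ≤ dist y z * (Real.exp (2 * B t) / 2) := by
      gcongr; linarith
    calc _ ≤ Real.exp (-(2 * B t)) * (dist y z * (Real.exp (2 * B t) / 2)) := by
          gcongr; exact h1.trans (h2.trans h4)
      _ = (Real.exp (-(2 * B t)) * Real.exp (2 * B t)) * (1 / 2 * dist y z) := by ring
      _ = _ := by rw [← Real.exp_add, neg_add_cancel, Real.exp_zero]; norm_num
  have : Nonempty C(Set.Icc 0 T, E) := ⟨0⟩
  set y := ContractingWith.fixedPoint Φ hΦ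
  have hy : Φ y = y := hΦ.fixedPoint_isFixedPt
  refine ⟨ext y, hext y, fun t ht => ?_⟩
  rw [hextv y t ht]
  conv_lhs => rw [← hy]
  simp only [Φ, ContinuousMap.coe_mk]
  rw [smul_smul, ← Real.exp_add, add_neg_cancel, Real.exp_zero, one_smul]

end Gronwall

/-! ### The control system: growth, existence, uniqueness, dependence on the parameter -/

section Fields

variable {d k l : ℕ} {T : ℝ}

/-- The right-hand side of the control system. -/
noncomputable def field (F₀ : Vec d → Vec l → Vec d) (F : Vec d → Vec l → Fin k → Vec d)
    (θ : Vec l) (x : Vec d) (w : Vec k) : Vec d :=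
  F₀ x θ + ∑ i, w i • F x θ i

/-- The factor which controls the dependence of the fields on the control. -/
noncomputable def controlRate (u : ℝ → Vec k) (s : ℝ) : ℝ := 1 + k * ‖u s‖

theorem one_le_controlRate (u : ℝ → Vec k) (s : ℝ) : 1 ≤ controlRate u s := by
  unfold controlRate; have : 0 ≤ (k : ℝ) * ‖u s‖ := by positivity
  linarith

theorem controlRate_nonneg (u : ℝ → Vec k) (s : ℝ) : 0 ≤ controlRate u s :=
  zero_le_one.trans (one_le_controlRate u s)

theorem intervalIntegrable_controlRate {u : ℝ → Vec k} {a b : ℝ}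
    (hu : IntervalIntegrable u volume a b) :
    IntervalIntegrable (controlRate u) volume a b :=
  intervalIntegrable_const.add (hu.norm.const_mul _)

/-- Quantitative form of the standing hypothesis on the fields. -/
structure FieldBounds (Θ : Set (Vec l)) (F₀ : Vec d → Vec l → Vec d)
    (F : Vec d → Vec l → Fin k → Vec d) (L M : ℝ) : Prop where
  pos : 0 < L
  nonneg : 0 ≤ M
  drift_lip : ∀ x₁ x₂, ∀ θ₁ ∈ Θ, ∀ θ₂ ∈ Θ,
    ‖F₀ x₁ θ₁ - F₀ x₂ θ₂‖ ≤ L * (‖x₁ - x₂‖ + ‖x₁ + x₂‖ * ‖θ₁ - θ₂‖)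
  fields_lip : ∀ x₁ x₂, ∀ θ₁ ∈ Θ, ∀ θ₂ ∈ Θ, ∀ i,
    ‖F x₁ θ₁ i - F x₂ θ₂ i‖ ≤ L * (‖x₁ - x₂‖ + ‖x₁ + x₂‖ * ‖θ₁ - θ₂‖)
  drift_le : ∀ x, ∀ θ ∈ Θ, ‖F₀ x θ‖ ≤ L * ‖x‖ + M
  fields_le : ∀ x, ∀ θ ∈ Θ, ∀ i, ‖F x θ i‖ ≤ L * ‖x‖ + M

/-- At `x₁ = x₂ = 0` the factor `‖x₁ + x₂‖` vanishes, so the fields at the origin do not depend on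
`θ`. Their values at a single `θ₀` therefore give the growth constant `M` for all parameters. -/
theorem LipschitzFields.exists_fieldBounds {Θ : Set (Vec l)} {F₀ : Vec d → Vec l → Vec d}
    {F : Vec d → Vec l → Fin k → Vec d} (hF : LipschitzFields Θ F₀ F) :
    ∃ L M, FieldBounds Θ F₀ F L M := by
  obtain ⟨L, hL, h⟩ := hF
  rcases Θ.eq_empty_or_nonempty with rfl | ⟨θ₀, hθ₀⟩
  · exact ⟨L, 0, hL, le_rfl, by simp, by simp, by simp, by simp⟩
  have hsum : 0 ≤ ∑ j, ‖F 0 θ₀ j‖ := by positivity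
  refine ⟨L, ‖F₀ 0 θ₀‖ + ∑ j, ‖F 0 θ₀ j‖, hL, by positivity,
    fun x₁ x₂ θ₁ h₁ θ₂ h₂ => (h x₁ x₂ θ₁ h₁ θ₂ h₂).1,
    fun x₁ x₂ θ₁ h₁ θ₂ h₂ => (h x₁ x₂ θ₁ h₁ θ₂ h₂).2, fun x θ hθ => ?_, fun x θ hθ i => ?_⟩
  · have h1 := (h x 0 θ hθ θ hθ).1
    have h2 := (h 0 0 θ hθ θ₀ hθ₀).1
    simp only [sub_zero, sub_self, norm_zero, mul_zero, add_zero, zero_mul,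
      norm_le_zero_iff, sub_eq_zero] at h1 h2
    have h3 := norm_le_insert' (F₀ x θ) (F₀ 0 θ)
    rw [h2] at h1 h3
    linarith
  · have h1 := (h x 0 θ hθ θ hθ).2 i
    have h2 := (h 0 0 θ hθ θ₀ hθ₀).2 i
    simp only [sub_zero, sub_self, norm_zero, mul_zero, add_zero, zero_mul,
      norm_le_zero_iff, sub_eq_zero] at h1 h2
    have h3 := norm_le_insert' (F x θ i) (F 0 θ i)
    have h4 : ‖F 0 θ₀ i‖ ≤ ∑ j, ‖F 0 θ₀ j‖ :=
      Finset.single_le_sum (f := fun j => ‖F 0 θ₀ j‖) (fun _ _ => norm_nonneg _)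
        (Finset.mem_univ i)
    rw [h2] at h1 h3
    have := norm_nonneg (F₀ 0 θ₀)
    linarith

theorem norm_sum_smul_le {w : Vec k} {v : Fin k → Vec d} {c : ℝ} (h : ∀ i, ‖v i‖ ≤ c) :
    ‖∑ i, w i • v i‖ ≤ k * ‖w‖ * c := by
  calc ‖∑ i, w i • v i‖ ≤ ∑ i : Fin k, ‖w‖ * c := by
        refine norm_sum_le_of_le _ fun i _ => ?_
        rw [norm_smul]
        exact mul_le_mul (PiLp.norm_apply_le w i) (h i) (norm_nonneg _) (norm_nonneg _)
    _ = _ := by simp; ring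

namespace FieldBounds

variable {Θ : Set (Vec l)} {F₀ : Vec d → Vec l → Vec d} {F : Vec d → Vec l → Fin k → Vec d}
  {L M : ℝ}

theorem norm_field_sub_le (h : FieldBounds Θ F₀ F L M) {θ₁ θ₂ : Vec l} (h₁ : θ₁ ∈ Θ)
    (h₂ : θ₂ ∈ Θ) (x₁ x₂ : Vec d) (u : ℝ → Vec k) (s : ℝ) :
    ‖field F₀ F θ₁ x₁ (u s) - field F₀ F θ₂ x₂ (u s)‖
      ≤ L * controlRate u s * (‖x₁ - x₂‖ + ‖x₁ + x₂‖ * ‖θ₁ - θ₂‖) := by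
  have h3 := h.drift_lip x₁ x₂ θ₁ h₁ θ₂ h₂
  have h4 := norm_sum_smul_le (w := u s) (h.fields_lip x₁ x₂ θ₁ h₁ θ₂ h₂)
  have : field F₀ F θ₁ x₁ (u s) - field F₀ F θ₂ x₂ (u s)
      = (F₀ x₁ θ₁ - F₀ x₂ θ₂) + ∑ i, u s i • (F x₁ θ₁ i - F x₂ θ₂ i) := by
    simp only [field, smul_sub, Finset.sum_sub_distrib]; abel
  rw [this]
  refine (norm_add_le _ _).trans ((add_le_add h3 h4).trans (le_of_eq ?_))
  unfold controlRate; ring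

theorem norm_field_le (h : FieldBounds Θ F₀ F L M) {θ : Vec l} (hθ : θ ∈ Θ)
    (x : Vec d) (u : ℝ → Vec k) (s : ℝ) :
    ‖field F₀ F θ x (u s)‖ ≤ controlRate u s * (L * ‖x‖ + M) := by
  have h3 := h.drift_le x θ hθ
  have h4 := norm_sum_smul_le (w := u s) (h.fields_le x θ hθ)
  refine (norm_add_le _ _).trans ((add_le_add h3 h4).trans (le_of_eq ?_))
  unfold controlRate; ring

theorem continuous_drift (h : FieldBounds Θ F₀ F L M) {θ : Vec l} (hθ : θ ∈ Θ) :
    Continuous fun x => F₀ x θ := by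
  refine (LipschitzWith.of_dist_le_mul (K := L.toNNReal) fun x y => ?_).continuous
  have := h.drift_lip x y θ hθ θ hθ
  simpa [dist_eq_norm, Real.coe_toNNReal L h.pos.le] using this

theorem continuous_fields (h : FieldBounds Θ F₀ F L M) {θ : Vec l} (hθ : θ ∈ Θ) (i : Fin k) :
    Continuous fun x => F x θ i := by
  refine (LipschitzWith.of_dist_le_mul (K := L.toNNReal) fun x y => ?_).continuous
  have := h.fields_lip x y θ hθ θ hθ i
  simpa [dist_eq_norm, Real.coe_toNNReal L h.pos.le] using this

theorem intervalIntegrable_sum_fields (h : FieldBounds Θ F₀ F L M) {θ : Vec l} (hθ : θ ∈ Θ)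
    (hT : 0 ≤ T) {u : ℝ → Vec k} (hu : IntervalIntegrable u volume 0 T) {x : ℝ → Vec d}
    (hx : ContinuousOn x (Set.Icc 0 T)) :
    IntervalIntegrable (fun s => ∑ i, u s i • F (x s) θ i) volume 0 T := by
  have hsum := IntervalIntegrable.sum (μ := volume) (a := 0) (b := T) Finset.univ
    (f := fun (i : Fin k) s => u s i • F (x s) θ i) (fun i _ => by
      refine IntervalIntegrable.smul_continuousOn (f := fun s => u s i) ?_ ?_
      · rw [intervalIntegrable_iff] at hu ⊢
        exact (EuclideanSpace.proj (𝕜 := ℝ) i).integrable_comp hu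
      · rw [Set.uIcc_of_le hT]
        exact (h.continuous_fields hθ i).comp_continuousOn hx)
  have heq : (fun s => ∑ i, u s i • F (x s) θ i) = ∑ i, fun s => u s i • F (x s) θ i := by
    ext1 s
    simp
  rw [heq]
  exact hsum

theorem intervalIntegrable_field (h : FieldBounds Θ F₀ F L M) {θ : Vec l} (hθ : θ ∈ Θ)
    (hT : 0 ≤ T) {u : ℝ → Vec k} (hu : IntervalIntegrable u volume 0 T) {x : ℝ → Vec d}
    (hx : ContinuousOn x (Set.Icc 0 T)) :
    IntervalIntegrable (fun s => field F₀ F θ (x s) (u s)) volume 0 T := by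
  refine IntervalIntegrable.add ?_ (h.intervalIntegrable_sum_fields hθ hT hu hx)
  apply ContinuousOn.intervalIntegrable
  rw [Set.uIcc_of_le hT]
  exact (h.continuous_drift hθ).comp_continuousOn hx

theorem exists_isTrajectory (h : FieldBounds Θ F₀ F L M) {θ : Vec l} (hθ : θ ∈ Θ)
    (hT : 0 ≤ T) {u : ℝ → Vec k} (hu : IntervalIntegrable u volume 0 T) (x₀ : Vec l → Vec d) :
    ∃ x, IsTrajectory T F₀ F x₀ u θ x := by
  obtain ⟨x, hxc, hx⟩ := exists_continuous_integral_eq (β := fun s => L * controlRate u s)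
    (g := fun s y => field F₀ F θ y (u s)) hT
    (fun s => mul_nonneg h.pos.le (controlRate_nonneg u s))
    ((intervalIntegrable_controlRate hu).const_mul L)
    (fun x hx => h.intervalIntegrable_field hθ hT hu hx.continuousOn)
    (fun s x y => by simpa using h.norm_field_sub_le hθ hθ x y u s) (x₀ θ)
  exact ⟨x, hxc.continuousOn, h.intervalIntegrable_field hθ hT hu hxc.continuousOn, hx⟩

end FieldBounds

theorem integral_controlRate_le {u : ℝ → Vec k} (hu : IntervalIntegrable u volume 0 T) {t : ℝ}
    (ht : t ∈ Set.Icc 0 T) :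
    ∫ s in (0 : ℝ)..t, controlRate u s ≤ ∫ s in (0 : ℝ)..T, controlRate u s :=
  intervalIntegral.integral_mono_interval le_rfl ht.1 ht.2
    (ae_of_all _ fun s => controlRate_nonneg u s) (intervalIntegrable_controlRate hu)

theorem le_exp_of_le_add_integral_controlRate {u : ℝ → Vec k}
    (hu : IntervalIntegrable u volume 0 T) {L : ℝ} (hL : 0 < L) {φ : ℝ → ℝ}
    (hφ : ContinuousOn φ (Set.Icc 0 T))
    (hφ0 : ∀ t ∈ Set.Icc 0 T, 0 ≤ φ t) {A : ℝ} (hA : 0 ≤ A)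
    (hle : ∀ t ∈ Set.Icc 0 T, φ t ≤ A + ∫ s in (0 : ℝ)..t, L * controlRate u s * φ s)
    {K : ℝ} (hK : ∫ s in (0 : ℝ)..T, controlRate u s ≤ K) {t : ℝ} (ht : t ∈ Set.Icc 0 T) :
    φ t ≤ 2 * A * Real.exp (2 * (L * K)) := by
  have h1 := le_exp_of_le_add_integral (β := fun s => L * controlRate u s)
    (fun s => mul_nonneg hL.le (controlRate_nonneg u s))
    ((intervalIntegrable_controlRate hu).const_mul L) hφ hφ0 hle ht
  refine h1.trans ?_
  rw [intervalIntegral.integral_const_mul]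
  gcongr
  exact (integral_controlRate_le hu ht).trans hK

namespace IsTrajectory

variable {Θ : Set (Vec l)} {F₀ : Vec d → Vec l → Vec d} {F : Vec d → Vec l → Fin k → Vec d}
  {x₀ : Vec l → Vec d} {L M : ℝ}

theorem eq_integral_field {u : ℝ → Vec k} {θ : Vec l} {x : ℝ → Vec d}
    (hx : IsTrajectory T F₀ F x₀ u θ x) {t : ℝ} (ht : t ∈ Set.Icc 0 T) :
    x t = x₀ θ + ∫ s in (0 : ℝ)..t, field F₀ F θ (x s) (u s) := hx.eq_integral t ht

theorem intervalIntegrable_field {u : ℝ → Vec k} {θ : Vec l} {x : ℝ → Vec d}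
    (hx : IsTrajectory T F₀ F x₀ u θ x) {s t : ℝ} (hs : s ∈ Set.Icc 0 T) (ht : t ∈ Set.Icc 0 T) :
    IntervalIntegrable (fun r => field F₀ F θ (x r) (u r)) volume s t :=
  intervalIntegrable_subinterval hx.intervalIntegrable hs ht

/-- Grönwall with linear growth. The control enters only through `K`, which makes the bound uniform
over balls of controls. -/
theorem norm_le (h : FieldBounds Θ F₀ F L M) {u : ℝ → Vec k}
    (hu : IntervalIntegrable u volume 0 T) {θ : Vec l} (hθ : θ ∈ Θ) {x : ℝ → Vec d}
    (hx : IsTrajectory T F₀ F x₀ u θ x) {X K : ℝ} (hX : ‖x₀ θ‖ ≤ X)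
    (hK : ∫ s in (0 : ℝ)..T, controlRate u s ≤ K) {t : ℝ} (ht : t ∈ Set.Icc 0 T) :
    ‖x t‖ ≤ 2 * (X + K * M) * Real.exp (2 * (L * K)) := by
  have hT : 0 ≤ T := ht.1.trans ht.2
  have h0 : (0 : ℝ) ∈ Set.Icc 0 T := ⟨le_rfl, hT⟩
  have hr := intervalIntegrable_controlRate hu
  have hK0 : 0 ≤ K := le_trans
    (intervalIntegral.integral_nonneg hT fun s _ => controlRate_nonneg u s) hK
  have hM := h.nonneg
  refine le_exp_of_le_add_integral_controlRate (φ := fun t => ‖x t‖) hu h.pos hx.continuousOn.norm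
    (fun _ _ => norm_nonneg _) (add_nonneg ((norm_nonneg _).trans hX) (mul_nonneg hK0 hM))
    (fun t ht => ?_) hK ht
  have hsub : Set.uIcc 0 t ⊆ Set.Icc 0 T := by
    rw [Set.uIcc_of_le ht.1]; exact Set.Icc_subset_Icc le_rfl ht.2
  have hr' := intervalIntegrable_subinterval hr h0 ht
  have hi : IntervalIntegrable (fun s => L * controlRate u s * ‖x s‖) volume 0 t :=
    (hr'.const_mul L).mul_continuousOn (hx.continuousOn.norm.mono hsub)
  have h1 : ‖∫ s in (0 : ℝ)..t, field F₀ F θ (x s) (u s)‖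
      ≤ ∫ s in (0 : ℝ)..t, (L * controlRate u s * ‖x s‖ + controlRate u s * M) := by
    refine intervalIntegral.norm_integral_le_of_norm_le ht.1 (ae_of_all _ fun s _ => ?_)
      (hi.add (hr'.mul_const M))
    exact (h.norm_field_le hθ (x s) u s).trans (le_of_eq (by ring))
  rw [intervalIntegral.integral_add hi (hr'.mul_const M), intervalIntegral.integral_mul_const] at h1
  have h2 : (∫ s in (0 : ℝ)..t, controlRate u s) * M ≤ K * M :=
    mul_le_mul_of_nonneg_right ((integral_controlRate_le hu ht).trans hK) hM
  have h3 := norm_add_le (x₀ θ) (∫ s in (0 : ℝ)..t, field F₀ F θ (x s) (u s))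
  rw [← hx.eq_integral_field ht] at h3
  linarith

/-- Both curves have the same control, so their right-hand sides differ by a Lipschitz term,
absorbed by Grönwall, and a source proportional to `R * ‖θ₁ - θ₂‖`. Equal parameters give
uniqueness. -/
theorem norm_sub_le (h : FieldBounds Θ F₀ F L M) {u : ℝ → Vec k}
    (hu : IntervalIntegrable u volume 0 T) {θ₁ θ₂ : Vec l} (hθ₁ : θ₁ ∈ Θ) (hθ₂ : θ₂ ∈ Θ)
    {x₁ x₂ : ℝ → Vec d} (hx₁ : IsTrajectory T F₀ F x₀ u θ₁ x₁)
    (hx₂ : IsTrajectory T F₀ F x₀ u θ₂ x₂) {R K : ℝ} (hR : ∀ t ∈ Set.Icc 0 T, ‖x₁ t + x₂ t‖ ≤ R)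
    (hK : ∫ s in (0 : ℝ)..T, controlRate u s ≤ K) {t : ℝ} (ht : t ∈ Set.Icc 0 T) :
    ‖x₁ t - x₂ t‖
      ≤ 2 * (‖x₀ θ₁ - x₀ θ₂‖ + L * (K * (R * ‖θ₁ - θ₂‖))) * Real.exp (2 * (L * K)) := by
  have hT : 0 ≤ T := ht.1.trans ht.2
  have h0 : (0 : ℝ) ∈ Set.Icc 0 T := ⟨le_rfl, hT⟩
  have hr := intervalIntegrable_controlRate hu
  have hK0 : 0 ≤ K := le_trans
    (intervalIntegral.integral_nonneg hT fun s _ => controlRate_nonneg u s) hK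
  have hR0 : 0 ≤ R := (norm_nonneg _).trans (hR 0 h0)
  have hL := h.pos
  have hc := (hx₁.continuousOn.sub hx₂.continuousOn).norm
  refine le_exp_of_le_add_integral_controlRate (φ := fun t => ‖x₁ t - x₂ t‖) hu h.pos hc
    (fun _ _ => norm_nonneg _) (by positivity)
    (fun t ht => ?_) hK ht
  have hsub : Set.uIcc 0 t ⊆ Set.Icc 0 T := by
    rw [Set.uIcc_of_le ht.1]; exact Set.Icc_subset_Icc le_rfl ht.2
  have hr' := intervalIntegrable_subinterval hr h0 ht
  have hi : IntervalIntegrable (fun s => L * controlRate u s * ‖x₁ s - x₂ s‖) volume 0 t :=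
    (hr'.const_mul L).mul_continuousOn (hc.mono hsub)
  have hi₂ := (hr'.mul_const (R * ‖θ₁ - θ₂‖)).const_mul L
  have h1 : ‖∫ s in (0 : ℝ)..t, (field F₀ F θ₁ (x₁ s) (u s) - field F₀ F θ₂ (x₂ s) (u s))‖
      ≤ ∫ s in (0 : ℝ)..t, (L * controlRate u s * ‖x₁ s - x₂ s‖
        + L * (controlRate u s * (R * ‖θ₁ - θ₂‖))) := by
    refine intervalIntegral.norm_integral_le_of_norm_le ht.1 (ae_of_all _ fun s hs => ?_)
      (hi.add hi₂)
    refine (h.norm_field_sub_le hθ₁ hθ₂ (x₁ s) (x₂ s) u s).trans ?_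
    have h2 : ‖x₁ s + x₂ s‖ * ‖θ₁ - θ₂‖ ≤ R * ‖θ₁ - θ₂‖ :=
      mul_le_mul_of_nonneg_right (hR s ⟨hs.1.le, hs.2.trans ht.2⟩) (norm_nonneg _)
    have h3 := mul_le_mul_of_nonneg_left h2 (mul_nonneg hL.le (controlRate_nonneg u s))
    linarith
  rw [intervalIntegral.integral_add hi hi₂, intervalIntegral.integral_const_mul L,
    intervalIntegral.integral_mul_const,
    intervalIntegral.integral_sub (hx₁.intervalIntegrable_field h0 ht)
      (hx₂.intervalIntegrable_field h0 ht)] at h1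
  have h2 : L * ((∫ s in (0 : ℝ)..t, controlRate u s) * (R * ‖θ₁ - θ₂‖))
      ≤ L * (K * (R * ‖θ₁ - θ₂‖)) := by
    gcongr
    exact (integral_controlRate_le hu ht).trans hK
  have h3 : x₁ t - x₂ t = (x₀ θ₁ - x₀ θ₂) + ((∫ s in (0 : ℝ)..t, field F₀ F θ₁ (x₁ s) (u s))
      - ∫ s in (0 : ℝ)..t, field F₀ F θ₂ (x₂ s) (u s)) := by
    rw [hx₁.eq_integral_field ht, hx₂.eq_integral_field ht]; abel
  have h4 := norm_add_le (x₀ θ₁ - x₀ θ₂) ((∫ s in (0 : ℝ)..t, field F₀ F θ₁ (x₁ s) (u s))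
      - ∫ s in (0 : ℝ)..t, field F₀ F θ₂ (x₂ s) (u s))
  rw [← h3] at h4
  linarith

theorem eqOn (h : FieldBounds Θ F₀ F L M) {u : ℝ → Vec k}
    (hu : IntervalIntegrable u volume 0 T) {θ : Vec l} (hθ : θ ∈ Θ) {x₁ x₂ : ℝ → Vec d}
    (hx₁ : IsTrajectory T F₀ F x₀ u θ x₁) (hx₂ : IsTrajectory T F₀ F x₀ u θ x₂) :
    Set.EqOn x₁ x₂ (Set.Icc 0 T) := by
  intro t ht
  obtain ⟨R, hR⟩ := isCompact_Icc.exists_bound_of_continuousOn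
    (hx₁.continuousOn.add hx₂.continuousOn)
  have := norm_sub_le h hu hθ hθ hx₁ hx₂ hR le_rfl ht
  simpa [sub_eq_zero] using this

end IsTrajectory

end Fields

/-! ### Integral bounds for controls -/

section Controls

variable {T : ℝ} {k : ℕ} {p : ℝ≥0∞} [Fact (1 ≤ p)]

theorem integrable_control (u : Control T k p) : Integrable u (timeMeasure T) :=
  (Lp.memLp u).integrable Fact.out

theorem intervalIntegrable_control (hT : 0 ≤ T) (u : Control T k p) :
    IntervalIntegrable u volume 0 T := by
  rw [intervalIntegrable_iff_integrableOn_Icc_of_le hT]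
  exact integrable_control u

/-- Hölder's inequality on `(s, t]`. For `p = ∞` the convention `1 / 0 = 0` yields the correct
exponent 1. -/
theorem integral_norm_control_le (u : Control T k p) {s t : ℝ} (hs : 0 ≤ s) (hst : s ≤ t)
    (ht : t ≤ T) :
    ∫ r in s..t, ‖u r‖ ≤ ‖u‖ * (t - s) ^ (1 - 1 / p.toReal) := by
  have hle : (volume.restrict (Set.Ioc s t) : Measure ℝ) ≤ timeMeasure T :=
    Measure.restrict_mono (Set.Ioc_subset_Icc_self.trans (Set.Icc_subset_Icc hs ht)) le_rfl
  have hm : AEStronglyMeasurable u (volume.restrict (Set.Ioc s t)) :=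
    (Lp.aestronglyMeasurable u).mono_measure hle
  have h1 := eLpNorm_le_eLpNorm_mul_rpow_measure_univ (p := 1) (q := p) Fact.out hm
  have h2 := h1.trans (mul_le_mul_left (eLpNorm_mono_measure u hle) _)
  rw [intervalIntegral.integral_of_le hst, integral_norm_eq_lintegral_enorm hm,
    ← eLpNorm_one_eq_lintegral_enorm, Lp.norm_def]
  have hp : 0 ≤ 1 - 1 / p.toReal := by
    rw [sub_nonneg, one_div]
    by_cases hpt : p = ∞
    · simp [hpt]
    · apply inv_le_one_of_one_le₀
      rw [← ENNReal.toReal_one]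
      exact ENNReal.toReal_mono hpt Fact.out
  simp only [Measure.restrict_apply_univ, Real.volume_Ioc, ENNReal.toReal_one, div_one] at h2
  have h3 := ENNReal.toReal_mono (ENNReal.mul_ne_top (Lp.eLpNorm_ne_top u)
    (ENNReal.rpow_ne_top_of_nonneg hp ENNReal.ofReal_ne_top)) h2
  rwa [ENNReal.toReal_mul, ← ENNReal.toReal_rpow, ENNReal.toReal_ofReal (sub_nonneg.2 hst)] at h3

theorem exists_integral_controlRate_le (hT : 0 ≤ T) (ρ : ℝ) :
    ∃ K : ℝ, 0 ≤ K ∧ ∀ u : Control T k p, ‖u‖ ≤ ρ →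
      ∫ s in (0 : ℝ)..T, controlRate u s ≤ K := by
  -- The absolute value keeps the constant non-negative when `ρ < 0`.
  refine ⟨|T + k * (ρ * T ^ (1 - 1 / p.toReal))|, abs_nonneg _,
    fun u hu => le_trans ?_ (le_abs_self _)⟩
  have hi := (intervalIntegrable_control hT u).norm
  have h1 := integral_norm_control_le u le_rfl hT le_rfl
  rw [sub_zero] at h1
  unfold controlRate
  rw [intervalIntegral.integral_add intervalIntegrable_const (hi.const_mul _),
    intervalIntegral.integral_const_mul]
  simp only [intervalIntegral.integral_const, sub_zero, smul_eq_mul, mul_one]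
  gcongr
  exact h1.trans (mul_le_mul_of_nonneg_right hu (Real.rpow_nonneg hT _))

end Controls

/-! ### Weak continuity of the endpoint map on balls -/

section WeakContinuity

variable {d k l : ℕ} {T : ℝ} {p : ℝ≥0∞} [Fact (1 ≤ p)]

theorem continuous_clm_weakSpace {E : Type*} [NormedAddCommGroup E] [NormedSpace ℝ E]
    (Λ : E →L[ℝ] Vec d) : Continuous fun v : WeakSpace ℝ E => Λ ((toWeakSpace ℝ E).symm v) := by
  refine (PiLp.continuous_toLp 2 _).comp (g := WithLp.toLp 2)
    (f := fun (v : WeakSpace ℝ E) i => Λ ((toWeakSpace ℝ E).symm v) i) ?_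
  refine continuous_pi fun i => ?_
  exact WeakBilin.eval_continuous (topDualPairing ℝ E).flip
    ((EuclideanSpace.proj (𝕜 := ℝ) i).comp Λ)

/-- Weak convergence controls each time separately. Since the family is Hölder in `t`, uniformly on
the ball, finitely many grid times control all of `[0, T]`. -/
theorem eventually_forall_norm_clm_sub_le (hT : 0 < T)
    {Λ : ℝ → Control T k p →L[ℝ] Vec d} {c α : ℝ} (hα : 0 < α)
    (hΛ : ∀ s t, 0 ≤ s → s ≤ t → t ≤ T → ∀ w, ‖Λ t w - Λ s w‖ ≤ c * (‖w‖ * (t - s) ^ α))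
    {ρ : ℝ} (u : weakBall T k p ρ) {η : ℝ} (hη : 0 < η) :
    ∀ᶠ v in 𝓝 u, ∀ t ∈ Set.Icc 0 T, ‖Λ t ((toWeakSpace ℝ (Control T k p)).symm v.1)
      - Λ t ((toWeakSpace ℝ (Control T k p)).symm u.1)‖ ≤ η := by
  set ι := (toWeakSpace ℝ (Control T k p)).symm
  have hρ : 0 ≤ ρ := (norm_nonneg (ι u.1)).trans u.2
  have hlim : Tendsto (fun δ : ℝ => |c| * ((ρ + ρ) * δ ^ α)) (𝓝 0) (𝓝 0) := by
    have h1 : ContinuousAt (fun δ : ℝ => |c| * ((ρ + ρ) * δ ^ α)) 0 := by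
      have := Real.continuousAt_rpow_const 0 α (Or.inr hα.le)
      fun_prop
    simpa [ContinuousAt, Real.zero_rpow hα.ne'] using h1
  have hn : Tendsto (fun n : ℕ => T / n) atTop (𝓝 0) := tendsto_const_div_atTop_nhds_zero_nat T
  -- The mesh `T / n` makes the Hölder error of `v - u`, whose norm is at most `2ρ`, less than `η /
  -- 2`.
  obtain ⟨n, hn1, hn0⟩ :=
    (((hlim.comp hn).eventually (gt_mem_nhds (half_pos hη))).and (eventually_gt_atTop 0)).exists
  have hn0' : (0 : ℝ) < n := by exact_mod_cast hn0
  have hgrid : ∀ᶠ v in 𝓝 u, ∀ j ∈ Finset.range (n + 1),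
      ‖Λ (j * (T / n)) (ι v.1) - Λ (j * (T / n)) (ι u.1)‖ < η / 2 := by
    rw [eventually_all_finset]
    intro j _
    have hc : Continuous fun v : weakBall T k p ρ => Λ (j * (T / n)) (ι v.1) :=
      (continuous_clm_weakSpace _).comp continuous_subtype_val
    exact (tendsto_iff_norm_sub_tendsto_zero.1 (hc.tendsto u)).eventually (gt_mem_nhds (half_pos hη))
  filter_upwards [hgrid] with v hv t ht
  set j := ⌊t / (T / n)⌋₊
  have hTn : 0 < T / n := by positivity
  have hj0 : 0 ≤ t / (T / n) := div_nonneg ht.1 hTn.le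
  have hj1 : j * (T / n) ≤ t := (le_div_iff₀ hTn).1 (Nat.floor_le hj0)
  have hj2 : t - j * (T / n) ≤ T / n := by
    have := (div_lt_iff₀ hTn).1 (Nat.lt_floor_add_one (t / (T / n)))
    rw [add_mul, one_mul] at this
    exact sub_le_iff_le_add'.2 this.le
  have hjn : j ∈ Finset.range (n + 1) := by
    rw [Finset.mem_range, Nat.lt_succ_iff]
    apply Nat.floor_le_of_le
    rw [div_le_iff₀ hTn, mul_div_cancel₀ _ hn0'.ne']
    exact ht.2
  have h1 := hv j hjn
  have h2 := hΛ (j * (T / n)) t (by positivity) hj1 ht.2 (ι v.1 - ι u.1)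
  have h3 : ‖ι v.1 - ι u.1‖ ≤ ρ + ρ := (norm_sub_le _ _).trans (add_le_add v.2 u.2)
  have h4 : c * (‖ι v.1 - ι u.1‖ * (t - j * (T / n)) ^ α) ≤ |c| * ((ρ + ρ) * (T / n) ^ α) := by
    have h0 : 0 ≤ t - j * (T / n) := sub_nonneg.2 hj1
    gcongr
    exact le_abs_self c
  simp only [map_sub, Function.comp_apply] at h2 hn1
  have h5 := norm_add_le (Λ t (ι v.1) - Λ t (ι u.1)
    - (Λ (j * (T / n)) (ι v.1) - Λ (j * (T / n)) (ι u.1)))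
    (Λ (j * (T / n)) (ι v.1) - Λ (j * (T / n)) (ι u.1))
  rw [sub_add_cancel] at h5
  linarith

theorem ae_of_ae_timeMeasure {P : ℝ → Prop} (h : ∀ᵐ s ∂timeMeasure T, P s) {t : ℝ}
    (ht : t ∈ Set.Icc 0 T) : ∀ᵐ s, s ∈ Set.uIoc 0 t → P s := by
  rw [ae_restrict_iff' measurableSet_Icc] at h
  filter_upwards [h] with s hs hst
  rw [Set.uIoc_of_le ht.1] at hst
  exact hs ⟨hst.1.le, hst.2.trans ht.2⟩

variable {Θ : Set (Vec l)} {F₀ : Vec d → Vec l → Vec d} {F : Vec d → Vec l → Fin k → Vec d}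
  {x₀ : Vec l → Vec d} {L M : ℝ}

theorem FieldBounds.norm_integral_fields_le (h : FieldBounds Θ F₀ F L M) {θ : Vec l} (hθ : θ ∈ Θ)
    (hT : 0 ≤ T) {x : ℝ → Vec d} {C : ℝ} (hC : ∀ s ∈ Set.Icc 0 T, ‖x s‖ ≤ C)
    (v : Control T k p) {s t : ℝ} (hs : 0 ≤ s) (hst : s ≤ t) (ht : t ≤ T) :
    ‖∫ r in s..t, ∑ i, v r i • F (x r) θ i‖
      ≤ k * (L * C + M) * (‖v‖ * (t - s) ^ (1 - 1 / p.toReal)) := by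
  have hC0 : 0 ≤ C := (norm_nonneg _).trans (hC 0 ⟨le_rfl, hT⟩)
  have hL := h.pos
  have hM := h.nonneg
  have h1 : ‖∫ r in s..t, ∑ i, v r i • F (x r) θ i‖
      ≤ ∫ r in s..t, k * (L * C + M) * ‖v r‖ := by
    refine intervalIntegral.norm_integral_le_of_norm_le hst (ae_of_all _ fun r hr => ?_)
      ((intervalIntegrable_subinterval (intervalIntegrable_control hT v) ⟨hs, hst.trans ht⟩
        ⟨hs.trans hst, ht⟩).norm.const_mul _)
    refine (norm_sum_smul_le (c := L * C + M) fun i => ?_).trans (le_of_eq (by ring))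
    refine (h.fields_le (x r) θ hθ i).trans ?_
    have := hC r ⟨hs.trans hr.1.le, hr.2.trans ht⟩
    gcongr
  rw [intervalIntegral.integral_const_mul] at h1
  refine h1.trans ?_
  gcongr
  exact integral_norm_control_le v hs hst ht

/-- Along a fixed curve, the integrated controlled fields are bounded linear in the control. -/
theorem FieldBounds.exists_clm (h : FieldBounds Θ F₀ F L M) {θ : Vec l} (hθ : θ ∈ Θ)
    (hT : 0 ≤ T) {x : ℝ → Vec d} (hx : ContinuousOn x (Set.Icc 0 T)) {t : ℝ}
    (ht : t ∈ Set.Icc 0 T) : ∃ Λ : Control T k p →L[ℝ] Vec d,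
      ∀ v : Control T k p, Λ v = ∫ s in (0 : ℝ)..t, ∑ i, v s i • F (x s) θ i := by
  obtain ⟨C, hC⟩ := isCompact_Icc.exists_bound_of_continuousOn hx
  have h0 : (0 : ℝ) ∈ Set.Icc 0 T := ⟨le_rfl, hT⟩
  have hi (v : Control T k p) := intervalIntegrable_subinterval
    (h.intervalIntegrable_sum_fields hθ hT (intervalIntegrable_control hT v) hx) h0 ht
  let Λ : Control T k p →ₗ[ℝ] Vec d :=
    { toFun := fun v => ∫ s in (0 : ℝ)..t, ∑ i, v s i • F (x s) θ i
      map_add' := fun v w => by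
        rw [← intervalIntegral.integral_add (hi v) (hi w)]
        apply intervalIntegral.integral_congr_ae
        filter_upwards [ae_of_ae_timeMeasure (Lp.coeFn_add v w) ht] with s hs hst
        simp only [hs hst, Pi.add_apply, PiLp.add_apply, add_smul, Finset.sum_add_distrib]
      map_smul' := fun c v => by
        rw [RingHom.id_apply, ← intervalIntegral.integral_smul]
        apply intervalIntegral.integral_congr_ae
        filter_upwards [ae_of_ae_timeMeasure (Lp.coeFn_smul c v) ht] with s hs hst
        simp only [hs hst, Pi.smul_apply, PiLp.smul_apply, smul_eq_mul, mul_smul, Finset.smul_sum] }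
  refine ⟨Λ.mkContinuous (k * (L * C + M) * (t - 0) ^ (1 - 1 / p.toReal)) fun v => ?_,
    fun v => rfl⟩
  exact (h.norm_integral_fields_le hθ hT hC v le_rfl ht.1 ht.2).trans (le_of_eq (by ring))

theorem FieldBounds.isTrajectory_trajectory (h : FieldBounds Θ F₀ F L M) {θ : Vec l}
    (hθ : θ ∈ Θ) (hT : 0 ≤ T) (u : Control T k p) :
    IsTrajectory T F₀ F x₀ u θ (trajectory T F₀ F x₀ u θ) := by
  have hex := h.exists_isTrajectory hθ hT (intervalIntegrable_control hT u) x₀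
  rw [trajectory, dif_pos hex]
  exact hex.choose_spec

/-- With `x`, `y` the trajectories of `u`, `v`, the difference `y - x` is a term linear in `v - u`
along the fixed curve `x`, plus the integral of the difference of the fields at `y` and `x` under
the same control `v`. The first is uniformly small for `v` weakly near `u`; the second is handled by
Grönwall. -/
theorem FieldBounds.continuous_trajectory_endpoint (h : FieldBounds Θ F₀ F L M) {θ : Vec l}
    (hθ : θ ∈ Θ) (hT : 0 < T) (hp : 1 < p) (ρ : ℝ) :
    Continuous fun v : weakBall T k p ρ =>
      trajectory T F₀ F x₀ ((toWeakSpace ℝ (Control T k p)).symm v.1) θ T := by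
  rw [continuous_iff_continuousAt]
  intro u
  set ι := (toWeakSpace ℝ (Control T k p)).symm
  have h0 : (0 : ℝ) ∈ Set.Icc 0 T := ⟨le_rfl, hT.le⟩
  have hα : 0 < 1 - 1 / p.toReal := by
    rw [sub_pos, one_div]
    by_cases hpt : p = ∞
    · simp [hpt]
    · apply inv_lt_one_of_one_lt₀
      rw [← ENNReal.toReal_one]
      exact (ENNReal.toReal_lt_toReal ENNReal.one_ne_top hpt).2 hp
  obtain ⟨K, hK0, hK⟩ := exists_integral_controlRate_le (k := k) (p := p) hT.le ρ
  have hxt (v : weakBall T k p ρ) : IsTrajectory T F₀ F x₀ (ι v.1) θ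
    (trajectory T F₀ F x₀ (ι v.1) θ) := h.isTrajectory_trajectory hθ hT.le _
  set x := trajectory T F₀ F x₀ (ι u.1) θ with hx
  have hut := hxt u
  rw [← hx] at hut
  have hxc := hut.continuousOn
  obtain ⟨C, hC⟩ := isCompact_Icc.exists_bound_of_continuousOn hxc
  have hΛ := fun t : Set.Icc 0 T => h.exists_clm (p := p) hθ hT.le hxc t.2
  choose Λ hΛ using hΛ
  set Λ' : ℝ → Control T k p →L[ℝ] Vec d := fun t => Λ (Set.projIcc 0 T hT.le t)
  have hΛ' : ∀ t ∈ Set.Icc 0 T, ∀ v : Control T k p,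
      Λ' t v = ∫ s in (0 : ℝ)..t, ∑ i, v s i • F (x s) θ i := fun t ht v => by
    simp only [Λ', Set.projIcc_of_mem hT.le ht, hΛ]
  have hi (v : Control T k p) :=
    h.intervalIntegrable_sum_fields hθ hT.le (intervalIntegrable_control hT.le v) hxc
  have hholder : ∀ s t, 0 ≤ s → s ≤ t → t ≤ T → ∀ w, ‖Λ' t w - Λ' s w‖
      ≤ k * (L * C + M) * (‖w‖ * (t - s) ^ (1 - 1 / p.toReal)) := by
    intro s t hs hst ht w
    have hs' : s ∈ Set.Icc 0 T := ⟨hs, hst.trans ht⟩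
    have ht' : t ∈ Set.Icc 0 T := ⟨hs.trans hst, ht⟩
    rw [hΛ' t ht', hΛ' s hs', intervalIntegral.integral_interval_sub_left
      (intervalIntegrable_subinterval (hi w) h0 ht')
      (intervalIntegrable_subinterval (hi w) h0 hs')]
    exact h.norm_integral_fields_le hθ hT.le hC w hs hst ht
  rw [ContinuousAt, Metric.tendsto_nhds]
  intro ε hε
  have hη : 0 < ε / (4 * Real.exp (2 * (L * K))) := by positivity
  filter_upwards [eventually_forall_norm_clm_sub_le hT hα hholder u hη] with v hv
  set y := trajectory T F₀ F x₀ (ι v.1) θ with hy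
  have hyt := hxt v
  rw [← hy] at hyt
  have hvi := intervalIntegrable_control hT.le (ι v.1)
  have hc := (hyt.continuousOn.sub hxc).norm
  have hg := le_exp_of_le_add_integral_controlRate (φ := fun t => ‖y t - x t‖) hvi h.pos hc
    (fun _ _ => norm_nonneg _) hη.le (fun t ht => ?_) (hK _ v.2) ⟨hT.le, le_rfl⟩
  · rw [dist_eq_norm]
    refine hg.trans_lt ?_
    have : 2 * (ε / (4 * Real.exp (2 * (L * K)))) * Real.exp (2 * (L * K)) = ε / 2 := by
      field_simp; norm_num
    rw [this]; linarith
  · have hr' := intervalIntegrable_subinterval (intervalIntegrable_controlRate hvi) h0 ht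
    have hsub : Set.uIcc 0 t ⊆ Set.Icc 0 T := by
      rw [Set.uIcc_of_le ht.1]; exact Set.Icc_subset_Icc le_rfl ht.2
    have hiv := intervalIntegrable_subinterval (h.intervalIntegrable_field hθ hT.le hvi hxc) h0 ht
    have h1 : ‖∫ s in (0 : ℝ)..t, (field F₀ F θ (y s) (ι v.1 s) - field F₀ F θ (x s) (ι v.1 s))‖
        ≤ ∫ s in (0 : ℝ)..t, L * controlRate (ι v.1) s * ‖y s - x s‖ := by
      refine intervalIntegral.norm_integral_le_of_norm_le ht.1 (ae_of_all _ fun s _ => ?_)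
        ((hr'.const_mul L).mul_continuousOn (hc.mono hsub))
      simpa using h.norm_field_sub_le hθ hθ (y s) (x s) (ι v.1) s
    rw [intervalIntegral.integral_sub (hyt.intervalIntegrable_field h0 ht) hiv] at h1
    -- Along the same curve the drifts cancel, leaving only the part linear in the control.
    have h2 : (∫ s in (0 : ℝ)..t, field F₀ F θ (x s) (ι v.1 s))
        - ∫ s in (0 : ℝ)..t, field F₀ F θ (x s) (ι u.1 s) = Λ' t (ι v.1) - Λ' t (ι u.1) := by
      rw [hΛ' t ht, hΛ' t ht, ← intervalIntegral.integral_sub hiv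
        (hut.intervalIntegrable_field h0 ht), ← intervalIntegral.integral_sub
        (intervalIntegrable_subinterval (hi _) h0 ht)
        (intervalIntegrable_subinterval (hi _) h0 ht)]
      simp only [field, add_sub_add_left_eq_sub]
    have h3 : y t - x t = (Λ' t (ι v.1) - Λ' t (ι u.1))
        + ((∫ s in (0 : ℝ)..t, field F₀ F θ (y s) (ι v.1 s))
          - ∫ s in (0 : ℝ)..t, field F₀ F θ (x s) (ι v.1 s)) := by
      rw [← h2, hyt.eq_integral_field ht, hut.eq_integral_field ht]; abel
    rw [h3]
    exact (norm_add_le _ _).trans (add_le_add (hv t ht) h1)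

end WeakContinuity

/-! ### Weak compactness of balls from uniform convexity -/

section UniformConvexity

/-- Uniform convexity of a function on its sublevel sets, in terms of the midpoint gap. -/
def UniformlyConvexGap {E : Type*} [NormedAddCommGroup E] [NormedSpace ℝ E] (Φ : E → ℝ) : Prop :=
  ∀ R ε : ℝ, 0 < ε → ∃ δ > 0, ∀ x y, Φ x ≤ R → Φ y ≤ R →
    (Φ x + Φ y) / 2 - Φ ((1 / 2 : ℝ) • (x + y)) ≤ δ → ‖x - y‖ < ε

variable {E : Type*} [NormedAddCommGroup E] [NormedSpace ℝ E]

/-- A filtering family of closed convex sets, on which a uniformly convex function is bounded, has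
a common point. -/
theorem UniformlyConvexGap.exists_mem_of_directed [CompleteSpace E] {Φ : E → ℝ}
    (hΦ : UniformlyConvexGap Φ) (hΦ0 : ∀ x, 0 ≤ Φ x) {R : ℝ} {𝒞 : Set (Set E)}
    (hne : 𝒞.Nonempty) (hnon : ∀ C ∈ 𝒞, C.Nonempty) (hclosed : ∀ C ∈ 𝒞, IsClosed C)
    (hconv : ∀ C ∈ 𝒞, Convex ℝ C) (hinter : ∀ C ∈ 𝒞, ∀ D ∈ 𝒞, C ∩ D ∈ 𝒞)
    (hR : ∀ C ∈ 𝒞, ∀ x ∈ C, Φ x ≤ R) : ∃ x, ∀ C ∈ 𝒞, x ∈ C := by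
  set m : Set E → ℝ := fun C => sInf (Φ '' C)
  have hbdd : ∀ C : Set E, BddBelow (Φ '' C) := fun C => ⟨0, by rintro _ ⟨x, _, rfl⟩; exact hΦ0 x⟩
  have hmle : ∀ C, ∀ x ∈ C, m C ≤ Φ x := fun C x hx => csInf_le (hbdd C) ⟨x, hx, rfl⟩
  have hmbdd : BddAbove (m '' 𝒞) := by
    refine ⟨R, ?_⟩
    rintro _ ⟨C, hC, rfl⟩
    obtain ⟨x, hx⟩ := hnon C hC
    exact (hmle C x hx).trans (hR C hC x hx)
  set r := sSup (m '' 𝒞)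
  have hmr : ∀ C ∈ 𝒞, m C ≤ r := fun C hC => le_csSup hmbdd ⟨C, hC, rfl⟩
  -- Near-minimizers of `Φ` on the sets `C`, measured against the largest infimum `r`; these sets
  -- generate a Cauchy filter whose limit is the common point.
  let A : 𝒞 × {ε : ℝ // 0 < ε} → Set E := fun i => {x | x ∈ i.1.1 ∧ Φ x ≤ r + i.2.1}
  have hAne : ∀ i, (A i).Nonempty := by
    rintro ⟨⟨C, hC⟩, ⟨ε, hε⟩⟩
    obtain ⟨_, ⟨x, hx, rfl⟩, hlt⟩ := exists_lt_of_csInf_lt ((hnon C hC).image Φ)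
      (lt_add_of_pos_right (m C) hε)
    exact ⟨x, hx, hlt.le.trans (by have := hmr C hC; dsimp only; linarith)⟩
  have : Nonempty 𝒞 := hne.to_subtype
  have : Nonempty {ε : ℝ // 0 < ε} := ⟨⟨1, one_pos⟩⟩
  have hdir : Directed (· ≥ ·) fun i => 𝓟 (A i) := by
    rintro ⟨⟨C, hC⟩, ⟨ε, hε⟩⟩ ⟨⟨D, hD⟩, ⟨ε', hε'⟩⟩
    refine ⟨⟨⟨C ∩ D, hinter C hC D hD⟩, ⟨min ε ε', lt_min hε hε'⟩⟩, ?_, ?_⟩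
    · exact principal_mono.2 fun x hx => ⟨hx.1.1, hx.2.trans (by simp)⟩
    · exact principal_mono.2 fun x hx => ⟨hx.1.2, hx.2.trans (by simp)⟩
  have hneBot : NeBot (⨅ i, 𝓟 (A i)) :=
    iInf_neBot_of_directed' hdir fun i => principal_neBot_iff.2 (hAne i)
  have hmem : ∀ i, A i ∈ ⨅ i, 𝓟 (A i) := fun i => mem_iInf_of_mem i (mem_principal_self _)
  have hcauchy : Cauchy (⨅ i, 𝓟 (A i)) := by
    refine Metric.cauchy_iff.2 ⟨hneBot, fun ε hε => ?_⟩
    obtain ⟨δ, hδ, h⟩ := hΦ (r + 1) ε hε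
    have hδ' : 0 < min (δ / 2) 1 := by positivity
    obtain ⟨_, ⟨C, hC, rfl⟩, hlt⟩ := exists_lt_of_lt_csSup (hne.image m)
      (sub_lt_self r hδ')
    refine ⟨A ⟨⟨C, hC⟩, ⟨_, hδ'⟩⟩, hmem _, fun x hx y hy => ?_⟩
    have hx2 : Φ x ≤ r + min (δ / 2) 1 := hx.2
    have hy2 : Φ y ≤ r + min (δ / 2) 1 := hy.2
    -- Convexity puts the midpoint in `C`, so its value exceeds `r - min (δ / 2) 1`, while both
    -- endpoints are at most `r + min (δ / 2) 1`; the gap is then at most `δ`.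
    have hmid : (1 / 2 : ℝ) • (x + y) ∈ C := by
      rw [smul_add]
      exact hconv C hC hx.1 hy.1 (by norm_num) (by norm_num) (by norm_num)
    have h1 := hmle C _ hmid
    have h2 := min_le_left (δ / 2) 1
    have h3 := min_le_right (δ / 2) 1
    rw [dist_eq_norm]
    exact h x y (by linarith) (by linarith) (by linarith)
  obtain ⟨x, hx⟩ := CompleteSpace.complete hcauchy
  refine ⟨x, fun C hC => ?_⟩
  have hCm : C ∈ ⨅ i, 𝓟 (A i) :=
    mem_of_superset (hmem ⟨⟨C, hC⟩, ⟨1, one_pos⟩⟩) fun y hy => hy.1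
  exact (hclosed C hC).mem_of_frequently_of_tendsto (Eventually.frequently hCm)
    (tendsto_id'.2 hx)

/-- Closed balls are weakly compact, if some non-negative function bounded on them is uniformly convex. -/
theorem UniformlyConvexGap.isCompact_weak_closedBall [CompleteSpace E] {Φ : E → ℝ}
    (hΦ : UniformlyConvexGap Φ) (hΦ0 : ∀ x, 0 ≤ Φ x) {ρ R : ℝ}
    (hR : ∀ x, ‖x‖ ≤ ρ → Φ x ≤ R) :
    IsCompact {u : WeakSpace ℝ E | ‖(toWeakSpace ℝ E).symm u‖ ≤ ρ} := by
  rw [isCompact_iff_ultrafilter_le_nhds']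
  intro 𝒰 h𝒰
  let U : Ultrafilter E := 𝒰.map (toWeakSpace ℝ E).symm
  have hball : Metric.closedBall (0 : E) ρ ∈ U := by
    refine mem_of_superset h𝒰 fun u hu => ?_
    exact mem_closedBall_zero_iff.2 hu
  have hinterU : ∀ C ∈ U, (C ∩ Metric.closedBall (0 : E) ρ) ∈ U := fun C hC =>
    inter_mem hC hball
  -- The closed convex subsets of the ball that belong to the ultrafilter have a common point, which
  -- is the candidate for the weak limit.
  obtain ⟨x, hx⟩ := hΦ.exists_mem_of_directed hΦ0 (R := R)
    (𝒞 := {C | C ∈ U ∧ C ⊆ Metric.closedBall 0 ρ ∧ IsClosed C ∧ Convex ℝ C})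
    ⟨_, hball, subset_rfl, Metric.isClosed_closedBall, convex_closedBall _ _⟩
    (fun C hC => U.nonempty_of_mem hC.1) (fun C hC => hC.2.2.1) (fun C hC => hC.2.2.2)
    (fun C hC D hD => ⟨inter_mem hC.1 hD.1, Set.inter_subset_left.trans hC.2.1,
      hC.2.2.1.inter hD.2.2.1, hC.2.2.2.inter hD.2.2.2⟩)
    (fun C hC x hx => hR x (by simpa using hC.2.1 hx))
  have hxball : ‖x‖ ≤ ρ := by
    simpa using hx _ ⟨hball, subset_rfl, Metric.isClosed_closedBall, convex_closedBall _ _⟩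
  refine ⟨toWeakSpace ℝ E x, by simpa using hxball, ?_⟩
  have hlim : ∀ ℓ : StrongDual ℝ E, Tendsto ℓ U (𝓝 (ℓ x)) := by
    intro ℓ
    have hb : Metric.closedBall (0 : ℝ) (‖ℓ‖ * ρ) ∈ U.map ℓ := by
      refine mem_of_superset (x := Metric.closedBall (0 : E) ρ) hball fun y hy => ?_
      rw [mem_closedBall_zero_iff] at hy
      exact mem_closedBall_zero_iff.2 (ℓ.le_opNorm_of_le hy)
    obtain ⟨c, -, hc⟩ := (isCompact_closedBall (0 : ℝ) (‖ℓ‖ * ρ)).ultrafilter_le_nhds' _ hb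
    have hc' : Tendsto ℓ U (𝓝 c) := hc
    -- Every slab around the limit `c` of `ℓ` along the ultrafilter, cut with the ball, is in the
    -- family and so contains `x`.
    have hcx : ℓ x = c := by
      apply eq_of_forall_dist_le
      intro ε hε
      have hmem : ℓ ⁻¹' Metric.closedBall c ε ∈ U := hc' (Metric.closedBall_mem_nhds c hε)
      have := hx (ℓ ⁻¹' Metric.closedBall c ε ∩ Metric.closedBall 0 ρ)
        ⟨hinterU _ hmem, Set.inter_subset_right,
          (Metric.isClosed_closedBall.preimage ℓ.continuous).inter Metric.isClosed_closedBall,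
          ((convex_closedBall c ε).linear_preimage (ℓ : E →ₗ[ℝ] ℝ)).inter
            (convex_closedBall _ _)⟩
      exact this.1
    rwa [hcx]
  have hind : IsInducing fun (u : WeakSpace ℝ E) (ℓ : StrongDual ℝ E) =>
    ℓ ((toWeakSpace ℝ E).symm u) := ⟨rfl⟩
  rw [hind.nhds_eq_comap, ← map_le_iff_le_comap]
  exact tendsto_pi_nhds.2 hlim

end UniformConvexity

/-! ### Uniform convexity of the `p`-th power of the `L^p` norm -/

section NormPower

theorem Lp_norm_rpow_eq_integral {V α : Type*} [NormedAddCommGroup V] [MeasurableSpace α]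
    {μ : Measure α} {p : ℝ≥0∞} [Fact (1 ≤ p)] (hp : p ≠ ∞) (u : Lp V p μ) :
    ‖u‖ ^ p.toReal = ∫ t, ‖u t‖ ^ p.toReal ∂μ := by
  have hp0 : p ≠ 0 := (zero_lt_one.trans_le (Fact.out : 1 ≤ p)).ne'
  have hpr : 0 < p.toReal := ENNReal.toReal_pos hp0 hp
  have hi : 0 ≤ ∫ t, ‖u t‖ ^ p.toReal ∂μ :=
    integral_nonneg fun t => Real.rpow_nonneg (norm_nonneg _) _
  rw [Lp.norm_def, (Lp.memLp u).eLpNorm_eq_integral_rpow_norm hp0 hp,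
    ENNReal.toReal_ofReal (Real.rpow_nonneg hi _), ← Real.rpow_mul hi, inv_mul_cancel₀ hpr.ne',
    Real.rpow_one]

variable {V : Type*} [NormedAddCommGroup V] [NormedSpace ℝ V]

/-- For equal norms the strictness comes from the strictly convex space, for unequal norms from
strict convexity of `r ↦ r ^ q`. -/
theorem norm_rpow_midpoint_lt [StrictConvexSpace ℝ V] {q : ℝ} (hq : 1 < q) {a b : V}
    (hab : a ≠ b) : ‖(1 / 2 : ℝ) • (a + b)‖ ^ q < (‖a‖ ^ q + ‖b‖ ^ q) / 2 := by
  have hq0 : 0 < q := zero_lt_one.trans hq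
  by_cases h : ‖a‖ = ‖b‖
  · have := Real.rpow_lt_rpow (norm_nonneg _) ((norm_midpoint_lt_iff h).2 hab) hq0
    rw [← h]; linarith
  · have h1 := (strictConvexOn_rpow hq).2 (norm_nonneg a) (norm_nonneg b) h
      (show (0 : ℝ) < 1 / 2 by norm_num) (show (0 : ℝ) < 1 / 2 by norm_num) (by norm_num)
    have h2 : ‖(1 / 2 : ℝ) • (a + b)‖ ≤ (1 / 2 : ℝ) • ‖a‖ + (1 / 2 : ℝ) • ‖b‖ := by
      rw [norm_smul, smul_eq_mul, smul_eq_mul, ← mul_add, Real.norm_of_nonneg (by norm_num)]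
      exact mul_le_mul_of_nonneg_left (norm_add_le a b) (by norm_num)
    have h3 := (Real.rpow_le_rpow (norm_nonneg _) h2 hq0.le).trans_lt h1
    simp only [smul_eq_mul] at h3
    linarith

/-- All terms are homogeneous of degree `q`, so the unit sphere of `V × V` suffices. Where `η` times
the norms does not already dominate, compactness keeps the midpoint gap away from zero, and a large
`K` dominates the rest. -/
theorem exists_norm_sub_rpow_le [StrictConvexSpace ℝ V] [FiniteDimensional ℝ V] {q : ℝ}
    (hq : 1 < q) {η : ℝ} (hη : 0 < η) :
    ∃ K : ℝ, 0 < K ∧ ∀ a b : V, ‖a - b‖ ^ q ≤ η * (‖a‖ ^ q + ‖b‖ ^ q)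
      + K * ((‖a‖ ^ q + ‖b‖ ^ q) / 2 - ‖(1 / 2 : ℝ) • (a + b)‖ ^ q) := by
  have hq0 : 0 < q := zero_lt_one.trans hq
  have : ProperSpace (V × V) := FiniteDimensional.proper ℝ _
  set N : V × V → ℝ := fun z => ‖z.1‖ ^ q + ‖z.2‖ ^ q with hN
  set D : V × V → ℝ := fun z => ‖z.1 - z.2‖ ^ q with hD
  set g : V × V → ℝ := fun z =>
    (‖z.1‖ ^ q + ‖z.2‖ ^ q) / 2 - ‖(1 / 2 : ℝ) • (z.1 + z.2)‖ ^ q with hg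
  have hNc : Continuous N := by
    have := hq0.le
    exact (Continuous.rpow_const (by fun_prop) fun _ => Or.inr this).add
      (Continuous.rpow_const (by fun_prop) fun _ => Or.inr this)
  have hDc : Continuous D := Continuous.rpow_const (by fun_prop) fun _ => Or.inr hq0.le
  have hgc : Continuous g := (hNc.div_const 2).sub
    (Continuous.rpow_const (by fun_prop) fun _ => Or.inr hq0.le)
  have hg0 : ∀ z, 0 ≤ g z := by
    rintro ⟨a, b⟩
    by_cases h : a = b
    · subst h
      have : (1 / 2 : ℝ) • (a + a) = a := by rw [← two_smul ℝ a, smul_smul]; norm_num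
      simp only [hg, this]; linarith
    · exact (sub_pos.2 (norm_rpow_midpoint_lt hq h)).le
  have hcomp : IsCompact (Metric.sphere (0 : V × V) 1 ∩ {z | η * N z ≤ D z}) :=
    (isCompact_sphere _ _).inter_right (isClosed_le (hNc.const_mul η) hDc)
  have hsphere : ∃ K : ℝ, 0 < K ∧ ∀ z ∈ Metric.sphere (0 : V × V) 1, D z ≤ η * N z + K * g z := by
    rcases (Metric.sphere (0 : V × V) 1 ∩ {z | η * N z ≤ D z}).eq_empty_or_nonempty with he | hne
    · refine ⟨1, one_pos, fun z hz => ?_⟩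
      have h1 : ¬ η * N z ≤ D z := fun h => Set.eq_empty_iff_forall_notMem.1 he z ⟨hz, h⟩
      have := hg0 z
      linarith
    · obtain ⟨z₀, hz₀, hmin⟩ := hcomp.exists_isMinOn hne hgc.continuousOn
      obtain ⟨c, hc⟩ := hcomp.exists_bound_of_continuousOn hDc.continuousOn
      have hgz₀ : 0 < g z₀ := by
        apply sub_pos.2
        apply norm_rpow_midpoint_lt hq
        intro heq
        have h1 : η * N z₀ ≤ D z₀ := hz₀.2
        have h2 : D z₀ = 0 := by simp [hD, heq, Real.zero_rpow hq0.ne']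
        have h3 : ‖z₀‖ = 1 := by simpa using hz₀.1
        have h4 : 0 < ‖z₀.1‖ := by
          rw [Prod.norm_def, ← heq, max_self] at h3
          rw [h3]; exact one_pos
        have h5 : 0 < N z₀ := add_pos_of_pos_of_nonneg (Real.rpow_pos_of_pos h4 q)
          (Real.rpow_nonneg (norm_nonneg _) q)
        have := mul_pos hη h5
        linarith
      refine ⟨(|c| + 1) / g z₀, by positivity, fun z hz => ?_⟩
      have hNz : 0 ≤ η * N z := mul_nonneg hη.le
        (add_nonneg (Real.rpow_nonneg (norm_nonneg _) q) (Real.rpow_nonneg (norm_nonneg _) q))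
      by_cases h : η * N z ≤ D z
      · have h1 := (le_abs_self _).trans (hc z ⟨hz, h⟩)
        have h2 : g z₀ ≤ g z := hmin ⟨hz, h⟩
        have h3 : |c| + 1 ≤ (|c| + 1) / g z₀ * g z := by
          rw [div_mul_eq_mul_div, le_div_iff₀ hgz₀]
          exact mul_le_mul_of_nonneg_left h2 (by positivity)
        have := le_abs_self c
        linarith
      · have : 0 ≤ (|c| + 1) / g z₀ * g z := mul_nonneg (by positivity) (hg0 z)
        linarith
  obtain ⟨K, hK0, hK⟩ := hsphere
  refine ⟨K, hK0, fun a b => ?_⟩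
  change D (a, b) ≤ η * N (a, b) + K * g (a, b)
  by_cases hz : (a, b) = (0 : V × V)
  · obtain ⟨rfl, rfl⟩ := Prod.mk_eq_zero.1 hz
    simp [hD, hN, hg, Real.zero_rpow hq0.ne']
  have hr : 0 < ‖(a, b)‖ := norm_pos_iff.2 hz
  set r := ‖(a, b)‖
  have hs : ∀ v : V, ‖r⁻¹ • v‖ ^ q = (r ^ q)⁻¹ * ‖v‖ ^ q := fun v => by
    rw [norm_smul, Real.norm_of_nonneg (inv_nonneg.2 hr.le), Real.mul_rpow (by positivity)
      (norm_nonneg _), Real.inv_rpow hr.le]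
  have h1 := hK (r⁻¹ • (a, b)) (by
    rw [mem_sphere_zero_iff_norm, norm_smul, Real.norm_of_nonneg (inv_nonneg.2 hr.le)]
    exact inv_mul_cancel₀ hr.ne')
  simp only [hD, hN, hg, Prod.smul_fst, Prod.smul_snd, ← smul_sub, ← smul_add,
    smul_comm (1 / 2 : ℝ) r⁻¹, hs] at h1 ⊢
  have hrq : 0 < (r ^ q)⁻¹ := inv_pos.2 (Real.rpow_pos_of_pos hr q)
  refine le_of_mul_le_mul_left (h1.trans (le_of_eq (by ring))) hrq

variable {α : Type*} [MeasurableSpace α] {μ : Measure α} {p : ℝ≥0∞} [Fact (1 ≤ p)]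

/-- The pointwise inequality is integrated; `η` and `δ` are chosen so that its two terms contribute
at most `ε ^ q / 2` and `ε ^ q / 4`. -/
theorem uniformlyConvexGap_Lp [StrictConvexSpace ℝ V] [FiniteDimensional ℝ V] (hp1 : 1 < p)
    (hp : p ≠ ∞) : UniformlyConvexGap fun u : Lp V p μ => ‖u‖ ^ p.toReal := by
  intro R ε hε
  set q := p.toReal with hqdef
  have hq : 1 < q := by
    rw [hqdef, ← ENNReal.toReal_one]
    exact (ENNReal.toReal_lt_toReal ENNReal.one_ne_top hp).2 hp1
  have hq0 : 0 < q := zero_lt_one.trans hq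
  have hp0 : p ≠ 0 := (zero_lt_one.trans hp1).ne'
  have hεq : 0 < ε ^ q := Real.rpow_pos_of_pos hε q
  have hη : 0 < ε ^ q / (4 * (|R| + 1)) := by positivity
  obtain ⟨K, hK0, hK⟩ := exists_norm_sub_rpow_le (V := V) hq hη
  set η := ε ^ q / (4 * (|R| + 1)) with hηdef
  refine ⟨ε ^ q / (4 * K), by positivity, fun x y hx hy hgap => ?_⟩
  have hint : ∀ u : Lp V p μ, Integrable (fun t => ‖u t‖ ^ q) μ := fun u =>
    (Lp.memLp u).integrable_norm_rpow hp0 hp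
  have hsum : Integrable (fun t => ‖x t‖ ^ q + ‖y t‖ ^ q) μ := (hint x).add (hint y)
  have hmid := hint ((1 / 2 : ℝ) • (x + y))
  have h1 : ‖x - y‖ ^ q ≤ η * (‖x‖ ^ q + ‖y‖ ^ q)
      + K * ((‖x‖ ^ q + ‖y‖ ^ q) / 2 - ‖(1 / 2 : ℝ) • (x + y)‖ ^ q) := by
    simp only [hqdef, Lp_norm_rpow_eq_integral hp]
    simp only [← hqdef]
    have hgapi : Integrable (fun t => K * ((‖x t‖ ^ q + ‖y t‖ ^ q) / 2
        - ‖((1 / 2 : ℝ) • (x + y) : Lp V p μ) t‖ ^ q)) μ := ((hsum.div_const 2).sub hmid).const_mul K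
    rw [← integral_add (hint x) (hint y), ← integral_const_mul, ← integral_div,
      ← integral_sub (hsum.div_const 2) hmid, ← integral_const_mul,
      ← integral_add (hsum.const_mul η) hgapi]
    refine integral_mono_ae (hint (x - y))
      ((hsum.const_mul η).add hgapi) ?_
    filter_upwards [Lp.coeFn_sub x y, Lp.coeFn_smul (1 / 2 : ℝ) (x + y), Lp.coeFn_add x y]
      with t h1 h2 h3
    have := hK (x t) (y t)
    simp only [h1, h2, h3, Pi.sub_apply, Pi.smul_apply, Pi.add_apply]
    exact this
  have h2 : η * (‖x‖ ^ q + ‖y‖ ^ q) ≤ ε ^ q / 2 := by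
    calc η * (‖x‖ ^ q + ‖y‖ ^ q) ≤ η * (2 * (|R| + 1)) := by
          have := le_abs_self R
          gcongr; linarith
      _ = ε ^ q / 2 := by rw [hηdef]; field_simp; norm_num
  have h3 : K * ((‖x‖ ^ q + ‖y‖ ^ q) / 2 - ‖(1 / 2 : ℝ) • (x + y)‖ ^ q) ≤ ε ^ q / 4 := by
    refine (mul_le_mul_of_nonneg_left hgap hK0.le).trans (le_of_eq ?_)
    field_simp
  by_contra hle
  have := Real.rpow_le_rpow hε.le (not_lt.1 hle) hq0.le
  linarith

end NormPower

theorem isCompact_weakBall {T : ℝ} {k : ℕ} {p : ℝ≥0∞} [Fact (1 ≤ p)] (hp1 : 1 < p) (hp : p ≠ ∞)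
    (ρ : ℝ) : IsCompact (weakBall T k p ρ) :=
  (uniformlyConvexGap_Lp hp1 hp).isCompact_weak_closedBall
    (fun _ => Real.rpow_nonneg (norm_nonneg _) _)
    (fun _ hx => Real.rpow_le_rpow (norm_nonneg _) hx ENNReal.toReal_nonneg)

/-! ### Extended integrals of functions with an integrable lower bound -/

section ExtIntegral

variable {μ : Measure ℝ} {g c : ℝ → ℝ}

/-- The lower bound makes the negative part integrable, so `∞ - ∞` cannot occur, and the shift by
`c` reduces to a non-negative integrand, to which Fatou applies. Pointwise, `(g + c) + g⁻ = g⁺ + c`.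
-/
theorem extIntegral_eq_lintegral_sub (hg : AEMeasurable g μ) (hc : Integrable c μ)
    (hc0 : ∀ᵐ t ∂μ, 0 ≤ c t) (hgc : ∀ᵐ t ∂μ, -c t ≤ g t) :
    extIntegral μ g
      = ((∫⁻ t, ENNReal.ofReal (g t + c t) ∂μ : ℝ≥0∞) : EReal) - ((∫ t, c t ∂μ : ℝ) : EReal) := by
  have hcint : ∫⁻ t, ENNReal.ofReal (c t) ∂μ = ENNReal.ofReal (∫ t, c t ∂μ) :=
    (ofReal_integral_eq_lintegral_ofReal hc hc0).symm
  have hκ : 0 ≤ ∫ t, c t ∂μ := integral_nonneg_of_ae hc0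
  have hadd : (∫⁻ t, ENNReal.ofReal (g t + c t) ∂μ) + ∫⁻ t, ENNReal.ofReal (-g t) ∂μ
      = (∫⁻ t, ENNReal.ofReal (g t) ∂μ) + ∫⁻ t, ENNReal.ofReal (c t) ∂μ := by
    have hm : AEMeasurable (fun t => ENNReal.ofReal (g t + c t)) μ :=
      (hg.add hc.aemeasurable).ennreal_ofReal
    rw [← lintegral_add_left' hm, ← lintegral_add_left' hg.ennreal_ofReal]
    apply lintegral_congr_ae
    filter_upwards [hc0, hgc] with t h0 h1
    rcases le_total 0 (g t) with h | h
    · rw [ENNReal.ofReal_of_nonpos (neg_nonpos.2 h), add_zero, ENNReal.ofReal_add h h0]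
    · rw [ENNReal.ofReal_of_nonpos h, zero_add,
        ← ENNReal.ofReal_add (by linarith) (neg_nonneg.2 h)]
      congr 1; ring
  have hN : ∫⁻ t, ENNReal.ofReal (-g t) ∂μ ≠ ∞ := by
    refine ne_top_of_le_ne_top (hcint ▸ ENNReal.ofReal_ne_top) (lintegral_mono_ae ?_)
    filter_upwards [hgc] with t h1
    exact ENNReal.ofReal_le_ofReal (by linarith)
  rw [hcint] at hadd
  unfold extIntegral
  generalize (∫⁻ t, ENNReal.ofReal (g t + c t) ∂μ) = H at *
  generalize (∫⁻ t, ENNReal.ofReal (g t) ∂μ) = P at *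
  generalize (∫⁻ t, ENNReal.ofReal (-g t) ∂μ) = N at *
  generalize (∫ t, c t ∂μ) = κ at *
  have hNr : (N : EReal) = ((N.toReal : ℝ) : EReal) := (EReal.coe_ennreal_toReal hN).symm
  by_cases hH : H = ∞
  · have hP : P = ∞ := by
      by_contra hP
      rw [hH, top_add] at hadd
      exact ENNReal.add_ne_top.2 ⟨hP, ENNReal.ofReal_ne_top⟩ hadd.symm
    rw [hH, hP, hNr, EReal.coe_ennreal_top, EReal.top_sub_coe, EReal.top_sub_coe]
  · have hP : P ≠ ∞ := fun hP => by
      rw [hP, top_add] at hadd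
      exact ENNReal.add_ne_top.2 ⟨hH, hN⟩ hadd
    lift H to NNReal using hH
    lift P to NNReal using hP
    lift N to NNReal using hN
    have h2 := congrArg ENNReal.toReal hadd
    rw [ENNReal.toReal_add (by simp) (by simp), ENNReal.toReal_add (by simp) (by simp),
      ENNReal.toReal_ofReal hκ] at h2
    simp only [ENNReal.coe_toReal] at h2
    simp only [EReal.coe_nnreal_eq_coe_real, ← EReal.coe_sub, EReal.coe_eq_coe_iff]
    linarith

theorem continuous_sub_coe_ereal (r : ℝ) : Continuous fun z : EReal => z - (r : EReal) := by
  rw [continuous_iff_continuousAt]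
  intro z
  have := (EReal.continuousAt_add (p := (z, -(r : EReal)))
    (Or.inr (by rw [← EReal.coe_neg]; exact EReal.coe_ne_bot _))
    (Or.inr (by rw [← EReal.coe_neg]; exact EReal.coe_ne_top _)))
  exact ContinuousAt.comp (f := fun z : EReal => (z, -(r : EReal))) this (by fun_prop)

end ExtIntegral

/-! ### The running cost: measurability, weak lower semicontinuity, coercivity -/

section RunningCost

variable {k : ℕ} {T : ℝ} {p : ℝ≥0∞} {f : ℝ → Vec k → ℝ}

/-- For simple `u` this is a finite sum of slices `f(·, w)`; continuity in `w` passes to the limit.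
-/
theorem RunningCost.aemeasurable_comp (hf : RunningCost T p f) {u : ℝ → Vec k}
    (hu : AEStronglyMeasurable u (timeMeasure T)) :
    AEMeasurable (fun t => f t (u t)) (timeMeasure T) := by
  have hs : ∀ s : SimpleFunc ℝ (Vec k), AEMeasurable (fun t => f t (s t)) (timeMeasure T) := by
    intro s
    have heq : (fun t => f t (s t))
        = fun t => ∑ w ∈ s.range, (s ⁻¹' {w}).indicator (fun t => f t w) t := by
      ext t
      rw [Finset.sum_eq_single (s t)]
      · simp
      · intro w _ hw
        exact Set.indicator_of_notMem (fun h => hw (by simpa using h.symm)) _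
      · intro h
        exact absurd (SimpleFunc.mem_range_self s t) h
    rw [heq]
    refine Finset.aemeasurable_fun_sum _ fun w _ => ?_
    exact (hf.measurable w).indicator (s.measurableSet_fiber w)
  refine aemeasurable_of_tendsto_metrizable_ae atTop
    (fun n => hs (hu.stronglyMeasurable_mk.approx n)) ?_
  filter_upwards [hf.continuous, hu.ae_eq_mk] with t ht hut
  rw [hut]
  exact (ht.tendsto _).comp (hu.stronglyMeasurable_mk.tendsto_approx t)

theorem RunningCost.exists_le (hf : RunningCost T p f) :
    ∃ (u : Control T k p) (κ : ℝ),
      extIntegral (timeMeasure T) (fun t => f t (u t)) ≤ (κ : EReal) := by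
  obtain ⟨w, c, hc, hc0, hfc⟩ := hf.finite
  refine ⟨(memLp_const w).toLp, ∫ t, c t ∂timeMeasure T, ?_⟩
  refine (EReal.sub_le_sub le_rfl (EReal.coe_ennreal_nonneg _)).trans ?_
  rw [sub_zero, ← max_eq_left (integral_nonneg_of_ae hc0), ← EReal.coe_ennreal_ofReal,
    ofReal_integral_eq_lintegral_ofReal hc hc0, EReal.coe_ennreal_le_coe_ennreal_iff]
  apply lintegral_mono_ae
  filter_upwards [hfc, (memLp_const (p := p) (μ := timeMeasure T) w).coeFn_toLp] with t h1 h2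
  rw [h2]
  exact ENNReal.ofReal_le_ofReal ((le_abs_self _).trans h1)

theorem RunningCost.exists_bound (hf : RunningCost T p f) : ∃ (c : ℝ → ℝ) (C : ℝ),
    0 < C ∧ Integrable c (timeMeasure T) ∧
    (∀ᵐ t ∂timeMeasure T, ∀ w, C * ‖w‖ ^ p.toReal - c t ≤ f t w) ∧
    (∀ᵐ t ∂timeMeasure T, ∀ w, -c t ≤ f t w) ∧
    ∀ u : ℝ → Vec k, AEStronglyMeasurable u (timeMeasure T) →
      extIntegral (timeMeasure T) (fun t => f t (u t))
        = ((∫⁻ t, ENNReal.ofReal (f t (u t) + c t) ∂timeMeasure T : ℝ≥0∞) : EReal)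
          - ((∫ t, c t ∂timeMeasure T : ℝ) : EReal) := by
  obtain ⟨c, C, hc, hc0, hC, hfc⟩ := hf.growth
  have hfc' : ∀ᵐ t ∂timeMeasure T, ∀ w, -c t ≤ f t w := by
    filter_upwards [hfc] with t ht w
    have : 0 ≤ C * ‖w‖ ^ p.toReal := mul_nonneg hC.le (Real.rpow_nonneg (norm_nonneg _) _)
    linarith [ht w]
  refine ⟨c, C, hC, hc, hfc, hfc', fun u hu => ?_⟩
  exact extIntegral_eq_lintegral_sub (hf.aemeasurable_comp hu) hc hc0 (hfc'.mono fun t ht => ht _)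

variable [Fact (1 ≤ p)]

/-- Fatou's lemma and convexity: integrals of non-negative normal convex integrands are weakly
lower semicontinuous. -/
theorem RunningCost.lowerSemicontinuous_lintegral (hf : RunningCost T p f) {c : ℝ → ℝ}
    (hc : AEMeasurable c (timeMeasure T))
    (hfc : ∀ᵐ t ∂timeMeasure T, ∀ w, -c t ≤ f t w) :
    LowerSemicontinuous fun v : WeakSpace ℝ (Control T k p) =>
      ∫⁻ t, ENNReal.ofReal (f t ((toWeakSpace ℝ (Control T k p)).symm v t) + c t)
        ∂timeMeasure T := by
  rw [lowerSemicontinuous_iff_isClosed_preimage]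
  intro y
  set S : Set (Control T k p) :=
    {u | ∫⁻ t, ENNReal.ofReal (f t (u t) + c t) ∂timeMeasure T ≤ y} with hS
  have hmeas : ∀ u : Control T k p,
      AEMeasurable (fun t => ENNReal.ofReal (f t (u t) + c t)) (timeMeasure T) := fun u =>
    ((hf.aemeasurable_comp (Lp.aestronglyMeasurable u)).add hc).ennreal_ofReal
  have hconv : Convex ℝ S := by
    intro u hu v hv a b ha hb hab
    have hle : ∫⁻ t, ENNReal.ofReal (f t ((a • u + b • v : Control T k p) t) + c t) ∂timeMeasure T
        ≤ ∫⁻ t, (ENNReal.ofReal a * ENNReal.ofReal (f t (u t) + c t)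
          + ENNReal.ofReal b * ENNReal.ofReal (f t (v t) + c t)) ∂timeMeasure T := by
      apply lintegral_mono_ae
      filter_upwards [hf.convex, hfc, Lp.coeFn_add (a • u) (b • v), Lp.coeFn_smul a u,
        Lp.coeFn_smul b v] with t h1 h2 h3 h4 h5
      have h6 := h1.2 (Set.mem_univ (u t)) (Set.mem_univ (v t)) ha hb hab
      have h7 := h2 (u t)
      have h8 := h2 (v t)
      rw [h3, Pi.add_apply, h4, h5, Pi.smul_apply, Pi.smul_apply, ← ENNReal.ofReal_mul ha,
        ← ENNReal.ofReal_mul hb, ← ENNReal.ofReal_add (mul_nonneg ha (by linarith))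
        (mul_nonneg hb (by linarith))]
      apply ENNReal.ofReal_le_ofReal
      simp only [smul_eq_mul] at h6
      have : c t = a * c t + b * c t := by rw [← add_mul, hab, one_mul]
      linarith
    rw [lintegral_add_left' ((hmeas u).const_mul _), lintegral_const_mul'' _ (hmeas u),
      lintegral_const_mul'' _ (hmeas v)] at hle
    calc _ ≤ _ := hle
      _ ≤ ENNReal.ofReal a * y + ENNReal.ofReal b * y :=
        add_le_add (mul_le_mul_right hu _) (mul_le_mul_right hv _)
      _ = y := by rw [← add_mul, ← ENNReal.ofReal_add ha hb, hab, ENNReal.ofReal_one, one_mul]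
  have hclosed : IsClosed S := by
    apply IsSeqClosed.isClosed
    intro u v hu huv
    -- An a.e. convergent subsequence suffices for Fatou, since the bound by `y` holds along the
    -- whole sequence.
    obtain ⟨ns, -, hns⟩ := (tendstoInMeasure_of_tendsto_Lp huv).exists_seq_tendsto_ae
    calc ∫⁻ t, ENNReal.ofReal (f t (v t) + c t) ∂timeMeasure T
        = ∫⁻ t, liminf (fun n => ENNReal.ofReal (f t (u (ns n) t) + c t)) atTop
          ∂timeMeasure T := by
          apply lintegral_congr_ae
          filter_upwards [hns, hf.continuous] with t h1 h2
          exact (Tendsto.liminf_eq ((ENNReal.continuous_ofReal.tendsto _).comp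
            (((h2.tendsto _).comp h1).add_const _))).symm
      _ ≤ liminf (fun n => ∫⁻ t, ENNReal.ofReal (f t (u (ns n) t) + c t) ∂timeMeasure T) atTop :=
        lintegral_liminf_le' fun n => hmeas _
      _ ≤ y := by
        refine (liminf_le_liminf (v := fun _ => y) (Eventually.of_forall fun n => hu (ns n))).trans
          (le_of_eq (by simp))
  -- Mazur: norm and weak closures of a convex set agree.
  have := hconv.toWeakSpace_closure ℝ
  rw [hclosed.closure_eq] at this
  have heq : (fun v : WeakSpace ℝ (Control T k p) =>
      ∫⁻ t, ENNReal.ofReal (f t ((toWeakSpace ℝ (Control T k p)).symm v t) + c t)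
        ∂timeMeasure T) ⁻¹' Set.Iic y = toWeakSpace ℝ (Control T k p) '' S := by
    rw [LinearEquiv.image_eq_preimage_symm]; rfl
  rw [heq, this]
  exact isClosed_closure

theorem RunningCost.lowerSemicontinuous (hf : RunningCost T p f) :
    LowerSemicontinuous fun v : WeakSpace ℝ (Control T k p) =>
      extIntegral (timeMeasure T) fun t => f t ((toWeakSpace ℝ (Control T k p)).symm v t) := by
  obtain ⟨c, C, -, hc, -, hfc, heq⟩ := hf.exists_bound
  simp_rw [fun v : WeakSpace ℝ (Control T k p) =>
    heq _ (Lp.aestronglyMeasurable ((toWeakSpace ℝ (Control T k p)).symm v))]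
  exact ((continuous_sub_coe_ereal _).comp continuous_coe_ennreal_ereal).comp_lowerSemicontinuous
    (hf.lowerSemicontinuous_lintegral hc.aemeasurable hfc)
    fun a b hab => EReal.sub_le_sub (EReal.coe_ennreal_le_coe_ennreal_iff.2 hab) le_rfl

theorem RunningCost.exists_coercive (hf : RunningCost T p f) (hp : p ≠ ∞) :
    ∃ C κ : ℝ, 0 < C ∧ ∀ u : Control T k p, ((C * ‖u‖ ^ p.toReal - κ : ℝ) : EReal)
      ≤ extIntegral (timeMeasure T) fun t => f t (u t) := by
  have hp0 : p ≠ 0 := (zero_lt_one.trans_le (Fact.out : 1 ≤ p)).ne'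
  obtain ⟨c, C, hC, hc, hfc, -, heq⟩ := hf.exists_bound
  refine ⟨C, ∫ t, c t ∂timeMeasure T, hC, fun u => ?_⟩
  rw [heq u (Lp.aestronglyMeasurable u), EReal.coe_sub]
  refine EReal.sub_le_sub ?_ le_rfl
  have hi : Integrable (fun t => C * ‖u t‖ ^ p.toReal) (timeMeasure T) :=
    ((Lp.memLp u).integrable_norm_rpow hp0 hp).const_mul C
  have hnn : ∀ t, 0 ≤ C * ‖u t‖ ^ p.toReal := fun t =>
    mul_nonneg hC.le (Real.rpow_nonneg (norm_nonneg _) _)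
  have h1 : ENNReal.ofReal (C * ‖u‖ ^ p.toReal)
      ≤ ∫⁻ t, ENNReal.ofReal (f t (u t) + c t) ∂timeMeasure T := by
    rw [Lp_norm_rpow_eq_integral hp, ← integral_const_mul,
      ofReal_integral_eq_lintegral_ofReal hi (ae_of_all _ hnn)]
    apply lintegral_mono_ae
    filter_upwards [hfc] with t ht
    exact ENNReal.ofReal_le_ofReal (by linarith [ht (u t)])
  have h2 := EReal.coe_ennreal_le_coe_ennreal_iff.2 h1
  rwa [EReal.coe_ennreal_ofReal, max_eq_left
    (mul_nonneg hC.le (Real.rpow_nonneg (norm_nonneg _) _))] at h2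

end RunningCost

/-! ### Uniform approximation implies Γ-convergence -/

section Gamma

theorem tendsto_ereal_of_le_add {α : ℕ → EReal} {b : EReal}
    (h : ∀ ε : ℝ, 0 < ε → ∀ᶠ N in atTop, α N ≤ b + (ε : EReal) ∧ b ≤ α N + (ε : EReal)) :
    Tendsto α atTop (𝓝 b) := by
  refine tendsto_order.2 ⟨fun c hc => ?_, fun c hc => ?_⟩
  · obtain ⟨r, hcr, hrb⟩ := EReal.lt_iff_exists_real_btwn.1 hc
    obtain ⟨r', hrr', hrb'⟩ := EReal.lt_iff_exists_real_btwn.1 hrb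
    have hε : 0 < r' - r := sub_pos.2 (EReal.coe_lt_coe_iff.1 hrr')
    filter_upwards [h _ hε] with N hN
    have h1 := EReal.sub_le_of_le_add (hrb'.le.trans hN.2)
    rw [← EReal.coe_sub, sub_sub_cancel] at h1
    exact hcr.trans_le h1
  · obtain ⟨r, hbr, hrc⟩ := EReal.lt_iff_exists_real_btwn.1 hc
    obtain ⟨r', hrr', hrc'⟩ := EReal.lt_iff_exists_real_btwn.1 hrc
    have hε : 0 < r' - r := sub_pos.2 (EReal.coe_lt_coe_iff.1 hrr')
    filter_upwards [h _ hε] with N hN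
    have h1 := hN.1.trans (add_le_add_left hbr.le _)
    rw [← EReal.coe_add, add_sub_cancel] at h1
    exact h1.trans_lt hrc'

variable {X : Type*} [TopologicalSpace X] {G : ℕ → X → EReal} {G' : X → EReal}

/-- Uniform convergence to a lower semicontinuous functional. -/
structure UniformApprox (G : ℕ → X → EReal) (G' : X → EReal) : Prop where
  lsc : LowerSemicontinuous G'
  approx : ∀ ε : ℝ, 0 < ε → ∀ᶠ N in atTop, ∀ x,
    G N x ≤ G' x + (ε : EReal) ∧ G' x ≤ G N x + (ε : EReal)

/-- The constant sequence is a recovery sequence; the liminf inequality is lower semicontinuity up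
to an arbitrarily small error. -/
theorem UniformApprox.gammaConverges (h : UniformApprox G G') : GammaConverges G G' where
  liminf_le u v huv := by
    refine le_of_forall_lt_imp_le_of_dense fun c hc => ?_
    obtain ⟨r, hcr, hrb⟩ := EReal.lt_iff_exists_real_btwn.1 hc
    obtain ⟨r', hrr', hrb'⟩ := EReal.lt_iff_exists_real_btwn.1 hrb
    have hε : 0 < r' - r := sub_pos.2 (EReal.coe_lt_coe_iff.1 hrr')
    refine le_liminf_of_le (by isBoundedDefault) ?_
    filter_upwards [h.approx _ hε, huv.eventually (h.lsc v _ hrb')] with N hN hN'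
    have h1 := EReal.sub_le_of_le_add (hN'.le.trans (hN (u N)).2)
    rw [← EReal.coe_sub, sub_sub_cancel] at h1
    exact hcr.le.trans h1
  limsup_le v := ⟨fun _ => v, tendsto_const_nhds, (tendsto_ereal_of_le_add fun ε hε =>
    (h.approx ε hε).mono fun _ hN => hN v).limsup_eq.le⟩

theorem UniformApprox.tendsto_iInf (h : UniformApprox G G') :
    Tendsto (fun N => ⨅ x, G N x) atTop (𝓝 (⨅ x, G' x)) := by
  refine tendsto_ereal_of_le_add fun ε hε => ?_
  have key : ∀ {g g' : X → EReal}, (∀ x, g x ≤ g' x + (ε : EReal)) →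
      ⨅ x, g x ≤ (⨅ x, g' x) + (ε : EReal) := by
    intro g g' hg
    have h1 : (⨅ x, g x) - (ε : EReal) ≤ ⨅ x, g' x :=
      le_iInf fun x => EReal.sub_le_of_le_add ((iInf_le g x).trans (hg x))
    exact (EReal.sub_le_iff_le_add (Or.inl (EReal.coe_ne_bot _))
      (Or.inl (EReal.coe_ne_top _))).1 h1
  filter_upwards [h.approx ε hε] with N hN
  exact ⟨key fun x => (hN x).1, key fun x => (hN x).2⟩

/-- If `G' w < r < r' < G' v`, lower semicontinuity gives `G' (u N) > r'` frequently, while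
minimality and two approximations at cost `(r' - r) / 2` each give the opposite. Only neighbourhoods
of `v` enter, so no convergent subsequence is needed. -/
theorem UniformApprox.isMinimizer_of_mapClusterPt (h : UniformApprox G G') {u : ℕ → X}
    (hu : ∀ N, IsMinimizer (G N) (u N)) {v : X} (hv : MapClusterPt v atTop u) :
    IsMinimizer G' v := by
  intro w
  by_contra hlt
  obtain ⟨r, hwr, hrv⟩ := EReal.lt_iff_exists_real_btwn.1 (not_le.1 hlt)
  obtain ⟨r', hrr', hrv'⟩ := EReal.lt_iff_exists_real_btwn.1 hrv
  have hε : 0 < (r' - r) / 2 := half_pos (sub_pos.2 (EReal.coe_lt_coe_iff.1 hrr'))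
  have hfreq := mapClusterPt_iff_frequently.1 hv _ (h.lsc v _ hrv')
  obtain ⟨N, hN, hN'⟩ := (hfreq.and_eventually (h.approx _ hε)).exists
  have h1 : G' (u N) ≤ (r' : EReal) := calc
    G' (u N) ≤ G N (u N) + (((r' - r) / 2 : ℝ) : EReal) := (hN' _).2
    _ ≤ G N w + (((r' - r) / 2 : ℝ) : EReal) := add_le_add_left (hu N w) _
    _ ≤ G' w + (((r' - r) / 2 : ℝ) : EReal) + (((r' - r) / 2 : ℝ) : EReal) :=
      add_le_add_left (hN' w).1 _
    _ ≤ (r : EReal) + (((r' - r) / 2 : ℝ) : EReal) + (((r' - r) / 2 : ℝ) : EReal) :=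
      add_le_add_left (add_le_add_left hwr.le _) _
    _ = (r' : EReal) := by rw [← EReal.coe_add, ← EReal.coe_add]; congr 1; ring
  exact absurd h1 (not_le.2 hN)

end Gamma

/-! ### The minimax functionals on balls -/

section Minimax

variable {d k l : ℕ} {T : ℝ} {p : ℝ≥0∞}
  {Θ : Set (Vec l)} {F₀ : Vec d → Vec l → Vec d} {F : Vec d → Vec l → Fin k → Vec d}
  {x₀ : Vec l → Vec d} {a : Vec d → Vec l → ℝ} {f : ℝ → Vec k → ℝ} {L M : ℝ}

theorem le_terminalSup {S : Set (Vec l)} {g : Vec l → ℝ} {θ : Vec l} (hθ : θ ∈ S) :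
    (g θ : EReal) ≤ ⨆ θ ∈ S, (g θ : EReal) :=
  le_iSup₂ (f := fun θ (_ : θ ∈ S) => (g θ : EReal)) θ hθ

/-- The running cost is the same on both sides, so only the suprema are compared and an infinite
integral does no harm. -/
theorem minimaxCost_le_add {S S' : Set (Vec l)} {u : Control T k p} {ε : ℝ}
    (hSS' : ∀ θ ∈ S, ∃ θ' ∈ S', a (trajectory T F₀ F x₀ u θ T) θ
      ≤ a (trajectory T F₀ F x₀ u θ' T) θ' + ε) :
    minimaxCost T F₀ F x₀ a f S u ≤ minimaxCost T F₀ F x₀ a f S' u + (ε : EReal) := by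
  unfold minimaxCost
  rw [add_right_comm]
  refine add_le_add_left (iSup₂_le fun θ hθ => ?_) _
  obtain ⟨θ', hθ', hle⟩ := hSS' θ hθ
  calc (a (trajectory T F₀ F x₀ u θ T) θ : EReal)
      ≤ (a (trajectory T F₀ F x₀ u θ' T) θ' : EReal) + (ε : EReal) := by
        rw [← EReal.coe_add]; exact EReal.coe_le_coe_iff.2 hle
    _ ≤ _ := add_le_add_left
      (le_terminalSup (g := fun θ => a (trajectory T F₀ F x₀ u θ T) θ) hθ') _

variable [Fact (1 ≤ p)]

/-- The terminal cost is equicontinuous in the parameter, uniformly over bounded controls. -/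
theorem FieldBounds.exists_terminalCost_modulus (h : FieldBounds Θ F₀ F L M) (hT : 0 ≤ T)
    (hΘ : IsCompact Θ) (hx₀ : ContinuousOn x₀ Θ) (ha : TerminalCost Θ a) (ρ : ℝ) {ε : ℝ}
    (hε : 0 < ε) :
    ∃ δ > 0, ∀ θ₁ ∈ Θ, ∀ θ₂ ∈ Θ, dist θ₁ θ₂ < δ → ∀ u : Control T k p, ‖u‖ ≤ ρ →
      dist (a (trajectory T F₀ F x₀ u θ₁ T) θ₁) (a (trajectory T F₀ F x₀ u θ₂ T) θ₂) < ε := by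
  obtain ⟨K, hK0, hK⟩ := exists_integral_controlRate_le (k := k) (p := p) hT ρ
  obtain ⟨X, hX⟩ := hΘ.exists_bound_of_continuousOn hx₀
  have hL := h.pos
  have hTT : T ∈ Set.Icc 0 T := ⟨hT, le_rfl⟩
  set R := |2 * (X + K * M) * Real.exp (2 * (L * K))| with hRdef
  have hR : ∀ θ ∈ Θ, ∀ u : Control T k p, ‖u‖ ≤ ρ → ∀ t ∈ Set.Icc 0 T,
      ‖trajectory T F₀ F x₀ u θ t‖ ≤ R := fun θ hθ u hu t ht =>
    ((h.isTrajectory_trajectory hθ hT u).norm_le h (intervalIntegrable_control hT u) hθ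
      (hX θ hθ) (hK u hu) ht).trans (le_abs_self _)
  have hR0 : 0 ≤ R := abs_nonneg _
  have huc := ((isCompact_closedBall (0 : Vec d) R).prod hΘ).uniformContinuousOn_of_continuous
    (ha.continuousOn.mono (Set.prod_mono (Set.subset_univ _) subset_rfl))
  obtain ⟨δ₁, hδ₁, hδ₁'⟩ := Metric.uniformContinuousOn_iff.1 huc ε hε
  set Q := Real.exp (2 * (L * K))
  have hQ : 0 < Q := Real.exp_pos _
  obtain ⟨δ₂, hδ₂, hδ₂'⟩ := Metric.uniformContinuousOn_iff.1
    (hΘ.uniformContinuousOn_of_continuous hx₀) (δ₁ / (8 * Q)) (by positivity)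
  -- The last two entries make the initial data and the parameter source contribute at most `δ₁ / 4`
  -- each; the `+ 1` keeps the denominator positive.
  refine ⟨min δ₁ (min δ₂ (δ₁ / (16 * Q * (L * (K * R) + 1)))), by positivity,
    fun θ₁ h₁ θ₂ h₂ hd u hu => ?_⟩
  have hd₁ : dist θ₁ θ₂ < δ₁ := hd.trans_le (min_le_left _ _)
  have hd₂ : dist θ₁ θ₂ < δ₂ := hd.trans_le ((min_le_right _ _).trans (min_le_left _ _))
  have hd₃ : dist θ₁ θ₂ < δ₁ / (16 * Q * (L * (K * R) + 1)) :=
    hd.trans_le ((min_le_right _ _).trans (min_le_right _ _))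
  have hsub := (h.isTrajectory_trajectory (x₀ := x₀) h₁ hT u).norm_sub_le h
    (intervalIntegrable_control hT u) h₁ h₂ (h.isTrajectory_trajectory h₂ hT u) (R := R + R)
    (fun t ht => (norm_add_le _ _).trans (add_le_add (hR θ₁ h₁ u hu t ht) (hR θ₂ h₂ u hu t ht)))
    (hK u hu) hTT
  have hx := hδ₂' θ₁ h₁ θ₂ h₂ hd₂
  rw [dist_eq_norm] at hx hd₃
  have hb₁ : 2 * ‖x₀ θ₁ - x₀ θ₂‖ * Q ≤ δ₁ / 4 := by
    calc 2 * ‖x₀ θ₁ - x₀ θ₂‖ * Q ≤ 2 * (δ₁ / (8 * Q)) * Q := by gcongr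
      _ = δ₁ / 4 := by field_simp; norm_num
  have hb₂ : 2 * (L * (K * ((R + R) * ‖θ₁ - θ₂‖))) * Q ≤ δ₁ / 4 := by
    calc 2 * (L * (K * ((R + R) * ‖θ₁ - θ₂‖))) * Q = (L * (K * R)) * (4 * Q * ‖θ₁ - θ₂‖) := by
          ring
      _ ≤ (L * (K * R) + 1) * (4 * Q * (δ₁ / (16 * Q * (L * (K * R) + 1)))) := by
          gcongr; linarith
      _ = δ₁ / 4 := by field_simp; norm_num
  refine hδ₁' (trajectory T F₀ F x₀ u θ₁ T, θ₁)
    ⟨mem_closedBall_zero_iff.2 (hR θ₁ h₁ u hu T hTT), h₁⟩ (trajectory T F₀ F x₀ u θ₂ T, θ₂)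
    ⟨mem_closedBall_zero_iff.2 (hR θ₂ h₂ u hu T hTT), h₂⟩ ?_
  rw [Prod.dist_eq, max_lt_iff]
  refine ⟨?_, hd₁⟩
  rw [dist_eq_norm]
  refine hsub.trans_lt ?_
  rw [mul_add, add_mul]
  linarith

theorem FieldBounds.continuousOn_terminalCost (h : FieldBounds Θ F₀ F L M) (hT : 0 ≤ T)
    (hΘ : IsCompact Θ) (hx₀ : ContinuousOn x₀ Θ) (ha : TerminalCost Θ a) (u : Control T k p) :
    ContinuousOn (fun θ => a (trajectory T F₀ F x₀ u θ T) θ) Θ := by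
  rw [Metric.continuousOn_iff]
  intro θ hθ ε hε
  obtain ⟨δ, hδ, hδ'⟩ := h.exists_terminalCost_modulus (p := p) hT hΘ hx₀ ha ‖u‖ hε
  exact ⟨δ, hδ, fun θ' hθ' hd => hδ' θ' hθ' θ hθ hd u le_rfl⟩

theorem RunningCost.extIntegral_ne_bot (hf : RunningCost T p f) (hp : p ≠ ∞)
    (u : Control T k p) : extIntegral (timeMeasure T) (fun t => f t (u t)) ≠ ⊥ := by
  obtain ⟨C, κ, -, h⟩ := hf.exists_coercive hp
  exact ne_bot_of_le_ne_bot (EReal.coe_ne_bot _) (h u)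

theorem minimaxCost_ne_bot (hf : RunningCost T p f) (hp : p ≠ ∞) {S : Set (Vec l)}
    (hS : S.Nonempty) (u : Control T k p) : minimaxCost T F₀ F x₀ a f S u ≠ ⊥ := by
  obtain ⟨θ, hθ⟩ := hS
  rw [minimaxCost, Ne, EReal.add_eq_bot_iff, not_or]
  exact ⟨ne_bot_of_le_ne_bot (EReal.coe_ne_bot _)
    (le_terminalSup (g := fun θ => a (trajectory T F₀ F x₀ u θ T) θ) hθ),
    hf.extIntegral_ne_bot hp u⟩

/-- A supremum of weakly continuous functions plus a weakly lower semicontinuous one. Addition in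
`EReal` is continuous here because neither summand is `⊥`; for the supremum this needs `S`
non-empty. -/
theorem lowerSemicontinuous_restrictBall_minimaxCost (h : FieldBounds Θ F₀ F L M) (hT : 0 < T)
    (ha : TerminalCost Θ a) (hf : RunningCost T p f) (hp1 : 1 < p) (hp : p ≠ ∞)
    {S : Set (Vec l)} (hSΘ : S ⊆ Θ) (hS : S.Nonempty) (ρ : ℝ) :
    LowerSemicontinuous
      (restrictBall ρ (minimaxCost (p := p) T F₀ F x₀ a f S)) := by
  refine LowerSemicontinuous.add' (f := fun u : weakBall T k p ρ => ⨆ θ ∈ S,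
    (a (trajectory T F₀ F x₀ ((toWeakSpace ℝ (Control T k p)).symm u.1) θ T) θ : EReal)) ?_
    (hf.lowerSemicontinuous.comp continuous_subtype_val) fun u => ?_
  · refine lowerSemicontinuous_biSup fun θ hθ => Continuous.lowerSemicontinuous ?_
    have h1 := h.continuous_trajectory_endpoint (p := p) (x₀ := x₀) (hSΘ hθ) hT hp1 ρ
    exact continuous_coe_real_ereal.comp (ha.continuousOn.comp_continuous
      (h1.prodMk (continuous_const (y := θ))) fun u => ⟨Set.mem_univ _, hSΘ hθ⟩)
  · obtain ⟨θ, hθ⟩ := hS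
    exact EReal.continuousAt_add (Or.inr (hf.extIntegral_ne_bot hp _))
      (Or.inl (ne_bot_of_le_ne_bot (EReal.coe_ne_bot _) (le_terminalSup (g := fun θ =>
        a (trajectory T F₀ F x₀ ((toWeakSpace ℝ (Control T k p)).symm u.1) θ T) θ) hθ)))

theorem uniformApprox_restrictBall_minimaxCost (h : FieldBounds Θ F₀ F L M) (hT : 0 < T)
    (hΘ : IsCompact Θ) (hx₀ : ContinuousOn x₀ Θ) (ha : TerminalCost Θ a)
    (hf : RunningCost T p f) (hp1 : 1 < p) (hp : p ≠ ∞) {ΘN : ℕ → Set (Vec l)}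
    (hΘN : ∀ N, ΘN N ⊆ Θ ∧ IsCompact (ΘN N) ∧ (ΘN N).Nonempty) {Θinf : Set (Vec l)}
    (hΘinf : Θinf ⊆ Θ ∧ IsCompact Θinf ∧ Θinf.Nonempty)
    (hlim : Tendsto (fun N => Metric.hausdorffDist (ΘN N) Θinf) atTop (𝓝 0)) (ρ : ℝ) :
    UniformApprox (fun N => restrictBall ρ (minimaxCost (p := p) T F₀ F x₀ a f (ΘN N)))
      (restrictBall ρ (minimaxCost (p := p) T F₀ F x₀ a f Θinf)) where
  lsc := lowerSemicontinuous_restrictBall_minimaxCost h hT ha hf hp1 hp hΘinf.1 hΘinf.2.2 ρ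
  approx ε hε := by
    obtain ⟨δ, hδ, hmod⟩ := h.exists_terminalCost_modulus (p := p) hT.le hΘ hx₀ ha ρ hε
    filter_upwards [hlim.eventually (gt_mem_nhds hδ)] with N hN u
    -- `hausdorffDist` is 0 by convention when the extended distance is infinite, so finiteness must
    -- be checked before points are matched.
    have hfin : Metric.hausdorffEDist (ΘN N) Θinf ≠ ⊤ :=
      Metric.hausdorffEDist_ne_top_of_nonempty_of_bounded (hΘN N).2.2 hΘinf.2.2
        (hΘN N).2.1.isBounded hΘinf.2.1.isBounded
    constructor
    · refine minimaxCost_le_add fun θ hθ => ?_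
      obtain ⟨θ', hθ', hd⟩ := Metric.exists_dist_lt_of_hausdorffDist_lt hθ hN hfin
      have := hmod θ ((hΘN N).1 hθ) θ' (hΘinf.1 hθ') hd _ u.2
      exact ⟨θ', hθ', by linarith [(abs_lt.1 this).2]⟩
    · refine minimaxCost_le_add fun θ hθ => ?_
      obtain ⟨θ', hθ', hd⟩ := Metric.exists_dist_lt_of_hausdorffDist_lt' hθ hN hfin
      have := hmod θ' ((hΘN N).1 hθ') θ (hΘinf.1 hθ) hd _ u.2
      exact ⟨θ', hθ', by linarith [(abs_lt.1 this).1]⟩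

/-- The minimizers of all the minimax functionals are bounded by a common constant. -/
theorem exists_norm_le_of_isMinimizer (h : FieldBounds Θ F₀ F L M) (hT : 0 ≤ T)
    (hΘ : IsCompact Θ) (hx₀ : ContinuousOn x₀ Θ) (ha : TerminalCost Θ a)
    (hf : RunningCost T p f) (hp : p ≠ ∞) :
    ∃ ρ : ℝ, 0 < ρ ∧ ∀ S ⊆ Θ, S.Nonempty → ∀ u : Control T k p,
      IsMinimizer (minimaxCost T F₀ F x₀ a f S) u → ‖u‖ ≤ ρ := by
  obtain ⟨C, κ, hC, hco⟩ := hf.exists_coercive hp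
  obtain ⟨u₀, κ', hu₀⟩ := hf.exists_le
  obtain ⟨A, hA⟩ := hΘ.exists_bound_of_continuousOn
    (h.continuousOn_terminalCost hT hΘ hx₀ ha u₀)
  -- A minimizer satisfies `C * ‖u‖ ^ p - κ ≤ A + κ'`, and `‖u‖ ≤ ‖u‖ ^ p` once `‖u‖ ≥ 1`. Since `A`
  -- bounds the terminal cost of `u₀` on all of `Θ`, the radius does not depend on `S`.
  refine ⟨max 1 ((A + κ' + κ) / C), by positivity, fun S hSΘ ⟨θ, hθ⟩ u hu => ?_⟩
  have h1 : minimaxCost T F₀ F x₀ a f S u₀ ≤ (A : EReal) + (κ' : EReal) := by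
    refine add_le_add (iSup₂_le fun θ hθ => EReal.coe_le_coe_iff.2 ?_) hu₀
    exact (le_abs_self _).trans (hA θ (hSΘ hθ))
  have h2 : (0 : EReal) + ((C * ‖u‖ ^ p.toReal - κ : ℝ) : EReal)
      ≤ minimaxCost T F₀ F x₀ a f S u := by
    refine add_le_add (le_trans ?_ (le_terminalSup
      (g := fun θ => a (trajectory T F₀ F x₀ u θ T) θ) hθ)) (hco u)
    exact EReal.coe_nonneg.2 (ha.nonneg _ θ (hSΘ hθ))
  have h3 := h2.trans ((hu u₀).trans h1)
  rw [zero_add, ← EReal.coe_add, EReal.coe_le_coe_iff] at h3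
  rcases le_total ‖u‖ 1 with h4 | h4
  · exact h4.trans (le_max_left _ _)
  · refine le_trans ?_ (le_max_right _ _)
    have hp1 : 1 ≤ p.toReal := by
      rw [← ENNReal.toReal_one]
      exact ENNReal.toReal_mono hp Fact.out
    have h5 := mul_le_mul_of_nonneg_left (Real.self_le_rpow_of_one_le h4 hp1) hC.le
    rw [le_div_iff₀ hC]
    linarith

end Minimax

end MinimaxEnsemble

/-! ### The main theorem -/

open MinimaxEnsemble in
theorem mainTheorem2 {d k l : ℕ} (T : ℝ) (hT : 0 < T)
    (p : ℝ≥0∞) [Fact (1 ≤ p)] (hp1 : 1 < p) (hp : p ≠ ∞)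
    (Θ : Set (Vec l)) (hΘ : IsCompact Θ)
    (F₀ : Vec d → Vec l → Vec d) (F : Vec d → Vec l → Fin k → Vec d) (hF : LipschitzFields Θ F₀ F)
    (x₀ : Vec l → Vec d) (hx₀ : ContinuousOn x₀ Θ)
    (a : Vec d → Vec l → ℝ) (ha : TerminalCost Θ a)
    (f : ℝ → Vec k → ℝ) (hf : RunningCost T p f)
    (ΘN : ℕ → Set (Vec l)) (hΘN : ∀ N, ΘN N ⊆ Θ ∧ IsCompact (ΘN N) ∧ (ΘN N).Nonempty)
    (Θinf : Set (Vec l)) (hΘinf : Θinf ⊆ Θ ∧ IsCompact Θinf ∧ Θinf.Nonempty)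
    (hlim : Tendsto (fun N => Metric.hausdorffDist (ΘN N) Θinf) atTop (𝓝 0))
    (JN : ℕ → Control T k p → EReal) (hJN : ∀ N, JN N = minimaxCost T F₀ F x₀ a f (ΘN N))
    (Jinf : Control T k p → EReal) (hJinf : Jinf = minimaxCost T F₀ F x₀ a f Θinf) :
    -- The functionals are well defined: the trajectories exist and are unique,
    -- the maxima are attained, and the value is never `-∞`.
    (∀ u : Control T k p, ∀ θ ∈ Θ,
      IsTrajectory T F₀ F x₀ u θ (trajectory T F₀ F x₀ u θ) ∧
      ∀ x, IsTrajectory T F₀ F x₀ u θ x →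
        Set.EqOn x (trajectory T F₀ F x₀ u θ) (Set.Icc 0 T)) ∧
    (∀ u : Control T k p, ∀ S : Set (Vec l), S ⊆ Θ → IsCompact S → S.Nonempty →
      (∃ θ ∈ S, IsMaxOn (fun θ => a (trajectory T F₀ F x₀ u θ T) θ) S θ) ∧
      minimaxCost T F₀ F x₀ a f S u ≠ ⊥) ∧
    -- Some ball contains all the minimizers.
    (∃ ρ : ℝ, 0 < ρ ∧ (∀ N u, IsMinimizer (JN N) u → ‖u‖ ≤ ρ) ∧
      ∀ u, IsMinimizer Jinf u → ‖u‖ ≤ ρ) ∧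
    -- On every such ball, with the weak topology:
    ∀ ρ : ℝ, 0 < ρ → (∀ N u, IsMinimizer (JN N) u → ‖u‖ ≤ ρ) →
      (∀ u, IsMinimizer Jinf u → ‖u‖ ≤ ρ) →
      GammaConverges (fun N => restrictBall ρ (JN N)) (restrictBall ρ Jinf) ∧
      Tendsto (fun N => ⨅ u, restrictBall ρ (JN N) u) atTop (𝓝 (⨅ u, restrictBall ρ Jinf u)) ∧
      ∀ u : ℕ → weakBall T k p ρ, (∀ N, IsMinimizer (restrictBall ρ (JN N)) (u N)) →
        IsCompact (closure (Set.range u)) ∧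
        ∀ v : weakBall T k p ρ, MapClusterPt v atTop u → IsMinimizer (restrictBall ρ Jinf) v := by
  subst hJinf
  obtain rfl : JN = fun N => minimaxCost T F₀ F x₀ a f (ΘN N) := funext hJN
  obtain ⟨L, M, h⟩ := hF.exists_fieldBounds
  refine ⟨fun u θ hθ => ?_, fun u S hSΘ hS hne => ⟨?_, minimaxCost_ne_bot hf hp hne u⟩, ?_,
    fun ρ _ _ _ => ?_⟩
  · have ht := h.isTrajectory_trajectory (x₀ := x₀) hθ hT.le u
    exact ⟨ht, fun x hx => hx.eqOn h (intervalIntegrable_control hT.le u) hθ ht⟩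
  · exact hS.exists_isMaxOn hne ((h.continuousOn_terminalCost hT.le hΘ hx₀ ha u).mono hSΘ)
  · obtain ⟨ρ, hρ, hmin⟩ := exists_norm_le_of_isMinimizer h hT.le hΘ hx₀ ha hf hp
    exact ⟨ρ, hρ, fun N u hu => hmin _ (hΘN N).1 (hΘN N).2.2 u hu,
      fun u hu => hmin _ hΘinf.1 hΘinf.2.2 u hu⟩
  · have happ := uniformApprox_restrictBall_minimaxCost h hT hΘ hx₀ ha hf hp1 hp hΘN hΘinf hlim ρ
    refine ⟨happ.gammaConverges, happ.tendsto_iInf, fun u hu => ⟨?_, fun v hv =>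
      happ.isMinimizer_of_mapClusterPt hu hv⟩⟩
    have := isCompact_iff_compactSpace.1 (isCompact_weakBall (T := T) (k := k) hp1 hp ρ)
    exact isClosed_closure.isCompact
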